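/- Let $n\ge 3$, let $M$ be a compact connected smooth $n$-manifold without boundary, let $(L,\bar g)$ be a smooth Lorentzian manifold of dimension $n+1$ and signature $(-,+,\dots,+)$, and let $f:M\to L$ be a smooth spacelike (immersed) hypersurface, i.e. $f$ is smooth and the induced metric $g=f^*\bar g$ is Riemannian. Let $N$ be a smooth timelike unit normal vector field along $f$, let $K(X,Y)=\bar g(\bar\nabla_X N,df(Y))$ be the second fundamental form, $H=\operatorname{trace}_g K$ the mean curvature, and $K_0=K-\frac1n Hg$ the traceless part of $K$. For a smooth one-form $\theta$ on $M$ with dual vector field $\xi=\theta^\sharp$ put $S\theta=\frac12 L_\xi g+\frac1n(\delta\theta)\,g$, where $\delta\theta=-\operatorname{div}\xi$ (the Cauchy–Ahlfors operator). A TT-tensor is a smooth symmetric covariant two-tensor that is trace free and divergence free with respect to $g$. Suppose that $K_0=S\theta+\varphi^{TT}$ for a smooth one-form $\theta$ and a TT-tensor $\varphi^{TT}$, the two summands being orthogonal in $L^2$, i.e. $\int_M g(S\theta,\varphi^{TT})\,dvol_g=0$. Suppose also that $(M,g,K)$ satisfies the vacuum constraint equations $$s-g(K,K)+(\operatorname{trace}_gK)^2=0,\qquad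 \operatorname{div}_gK-d(\operatorname{trace}_gK)=0,$$ where $s$ is the scalar curvature of $g$. Then $H$ is constant on $M$ if and only if $K=\frac1n H\,g+\varphi^{TT}$. -/

import Mathlib

-- This instance only obscures the standard charted space structure that a model space has on itself.
attribute [-instance] TopCat.of.chartedSpace

open scoped Manifold ContDiff Matrix

noncomputable section

namespace AhlforsVacuum

/-! ### Coordinate calculus on an open subset of `ℝᵐ`

`G` is the matrix of components of a metric, `A` the matrix of components of a covariant
two-tensor, `t` the vector of components of a one-form, all of them functions of the coordinates. -/

/-- The partial derivative `∂ᵢ u` at `x`. -/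
def pd {m : ℕ} (i : Fin m) (u : EuclideanSpace ℝ (Fin m) → ℝ) (x : EuclideanSpace ℝ (Fin m)) : ℝ :=
  fderiv ℝ u x (EuclideanSpace.single i 1)

/-- The Christoffel symbols of the Levi-Civita connection,
`Γᵏᵢⱼ = ½ gᵏˡ (∂ᵢ gⱼₗ + ∂ⱼ gᵢₗ - ∂ₗ gᵢⱼ)`. -/
def christoffel {m : ℕ} (G : EuclideanSpace ℝ (Fin m) → Matrix (Fin m) (Fin m) ℝ)
    (x : EuclideanSpace ℝ (Fin m)) (k i j : Fin m) : ℝ :=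
  (1 / 2) * ∑ l, (G x)⁻¹ k l *
    (pd i (fun y => G y j l) x + pd j (fun y => G y i l) x - pd l (fun y => G y i j) x)

/-- The Ricci tensor,
`Ricᵢⱼ = ∂ₖ Γᵏᵢⱼ - ∂ⱼ Γᵏᵢₖ + Γᵏₖₗ Γˡᵢⱼ - Γᵏⱼₗ Γˡᵢₖ` (positive on round spheres). -/
def ricci {m : ℕ} (G : EuclideanSpace ℝ (Fin m) → Matrix (Fin m) (Fin m) ℝ)
    (x : EuclideanSpace ℝ (Fin m)) (i j : Fin m) : ℝ :=
  ∑ k, (pd k (fun y => christoffel G y k i j) x - pd j (fun y => christoffel G y k i k) x) +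
    ∑ k, ∑ l, (christoffel G x k k l * christoffel G x l i j -
      christoffel G x k j l * christoffel G x l i k)

/-- The trace `gⁱʲ Aᵢⱼ` of a covariant two-tensor. -/
def matTrace {m : ℕ} (G A : Matrix (Fin m) (Fin m) ℝ) : ℝ :=
  ∑ i, ∑ j, G⁻¹ i j * A i j

/-- The inner product `g(A, B) = gⁱᵏ gʲˡ Aᵢⱼ Bₖₗ` of two covariant two-tensors. -/
def matInner {m : ℕ} (G A B : Matrix (Fin m) (Fin m) ℝ) : ℝ :=
  ∑ i, ∑ j, ∑ k, ∑ l, G⁻¹ i k * G⁻¹ j l * A i j * B k l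

/-- The scalar curvature `gⁱʲ Ricᵢⱼ`. -/
def scalarCurv {m : ℕ} (G : EuclideanSpace ℝ (Fin m) → Matrix (Fin m) (Fin m) ℝ)
    (x : EuclideanSpace ℝ (Fin m)) : ℝ :=
  matTrace (G x) (Matrix.of fun i j => ricci G x i j)

/-- The covariant derivative of a one-form, `∇ᵢ tⱼ = ∂ᵢ tⱼ - Γᵏᵢⱼ tₖ`. -/
def covDerivForm {m : ℕ} (G : EuclideanSpace ℝ (Fin m) → Matrix (Fin m) (Fin m) ℝ)
    (t : EuclideanSpace ℝ (Fin m) → Fin m → ℝ)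
    (x : EuclideanSpace ℝ (Fin m)) (i j : Fin m) : ℝ :=
  pd i (fun y => t y j) x - ∑ k, christoffel G x k i j * t x k

/-- The covariant derivative of a covariant two-tensor,
`∇ᵢ Aⱼₖ = ∂ᵢ Aⱼₖ - Γˡᵢⱼ Aₗₖ - Γˡᵢₖ Aⱼₗ`. -/
def covDerivTensor {m : ℕ} (G A : EuclideanSpace ℝ (Fin m) → Matrix (Fin m) (Fin m) ℝ)
    (x : EuclideanSpace ℝ (Fin m)) (i j k : Fin m) : ℝ :=
  pd i (fun y => A y j k) x -
    ∑ l, (christoffel G x l i j * A x l k + christoffel G x l i k * A x j l)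

/-- The codifferential `δt = -gⁱʲ ∇ᵢ tⱼ` of a one-form. -/
def codiff {m : ℕ} (G : EuclideanSpace ℝ (Fin m) → Matrix (Fin m) (Fin m) ℝ)
    (t : EuclideanSpace ℝ (Fin m) → Fin m → ℝ) (x : EuclideanSpace ℝ (Fin m)) : ℝ :=
  -∑ i, ∑ j, (G x)⁻¹ i j * covDerivForm G t x i j

/-- The divergence `(div A)ₖ = gⁱʲ ∇ᵢ Aⱼₖ` of a covariant two-tensor (so `δA = -div A`). -/
def divTensor {m : ℕ} (G A : EuclideanSpace ℝ (Fin m) → Matrix (Fin m) (Fin m) ℝ)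
    (x : EuclideanSpace ℝ (Fin m)) (k : Fin m) : ℝ :=
  ∑ i, ∑ j, (G x)⁻¹ i j * covDerivTensor G A x i j k

/-- The components `ξᵏ = gᵏˡ tₗ` of the vector field dual to a one-form. -/
def sharp {m : ℕ} (G : EuclideanSpace ℝ (Fin m) → Matrix (Fin m) (Fin m) ℝ)
    (t : EuclideanSpace ℝ (Fin m) → Fin m → ℝ)
    (x : EuclideanSpace ℝ (Fin m)) (k : Fin m) : ℝ :=
  ∑ l, (G x)⁻¹ k l * t x l

/-- The Lie derivative of the metric,
`(L_ξ g)ᵢⱼ = ξᵏ ∂ₖ gᵢⱼ + gₖⱼ ∂ᵢ ξᵏ + gᵢₖ ∂ⱼ ξᵏ`. -/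
def lieMetric {m : ℕ} (G : EuclideanSpace ℝ (Fin m) → Matrix (Fin m) (Fin m) ℝ)
    (ξ : EuclideanSpace ℝ (Fin m) → Fin m → ℝ)
    (x : EuclideanSpace ℝ (Fin m)) (i j : Fin m) : ℝ :=
  ∑ k, (ξ x k * pd k (fun y => G y i j) x + G x k j * pd i (fun y => ξ y k) x +
    G x i k * pd j (fun y => ξ y k) x)

/-- The Cauchy-Ahlfors operator `S t = ½ L_ξ g + (1/m) (δt) g`, where `ξ` is dual to `t`. -/
def ahlfors {m : ℕ} (G : EuclideanSpace ℝ (Fin m) → Matrix (Fin m) (Fin m) ℝ)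
    (t : EuclideanSpace ℝ (Fin m) → Fin m → ℝ)
    (x : EuclideanSpace ℝ (Fin m)) : Matrix (Fin m) (Fin m) ℝ :=
  Matrix.of fun i j =>
    (1 / 2) * lieMetric G (sharp G t) x i j + (1 / (m : ℝ)) * codiff G t x * G x i j

/-! ### Tensor fields on a manifold and their components in charts -/

section Tensors

variable (m : ℕ) (M : Type*) [TopologicalSpace M] [ChartedSpace (EuclideanSpace ℝ (Fin m)) M]

/-- (Not necessarily smooth) one-forms on an `m`-dimensional manifold. -/
abbrev Form : Type _ := ∀ p : M, TangentSpace (𝓡 m) p →L[ℝ] ℝ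

/-- (Not necessarily smooth) covariant two-tensors on an `m`-dimensional manifold. -/
abbrev Tensor2 : Type _ :=
  ∀ p : M, TangentSpace (𝓡 m) p →L[ℝ] TangentSpace (𝓡 m) p →L[ℝ] ℝ

end Tensors

section Manifold

variable {m : ℕ} {M : Type*} [TopologicalSpace M] [ChartedSpace (EuclideanSpace ℝ (Fin m)) M]

/-- Smoothness of a one-form, as a section of the cotangent bundle. -/
def SmoothForm [IsManifold (𝓡 m) ∞ M] (θ : Form m M) : Prop :=
  ContMDiff (𝓡 m) ((𝓡 m).prod 𝓘(ℝ, EuclideanSpace ℝ (Fin m) →L[ℝ] ℝ)) ∞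
    (fun p => Bundle.TotalSpace.mk' (EuclideanSpace ℝ (Fin m) →L[ℝ] ℝ)
      (E := fun p : M => TangentSpace (𝓡 m) p →L[ℝ] ℝ) p (θ p))

/-- Smoothness of a covariant two-tensor, as a section of the bundle of bilinear forms. -/
def SmoothTensor2 [IsManifold (𝓡 m) ∞ M] (T : Tensor2 m M) : Prop :=
  ContMDiff (𝓡 m)
    ((𝓡 m).prod 𝓘(ℝ, EuclideanSpace ℝ (Fin m) →L[ℝ] EuclideanSpace ℝ (Fin m) →L[ℝ] ℝ)) ∞
    (fun p => Bundle.TotalSpace.mk'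
      (EuclideanSpace ℝ (Fin m) →L[ℝ] EuclideanSpace ℝ (Fin m) →L[ℝ] ℝ)
      (E := fun p : M => TangentSpace (𝓡 m) p →L[ℝ] TangentSpace (𝓡 m) p →L[ℝ] ℝ) p (T p))

/-- The coordinate vector `∂ᵢ` of the chart `e`, at the point with coordinates `x`. -/
def coordVec (e : OpenPartialHomeomorph M (EuclideanSpace ℝ (Fin m)))
    (x : EuclideanSpace ℝ (Fin m)) (i : Fin m) : TangentSpace (𝓡 m) (e.symm x) :=
  mfderiv (𝓡 m) (𝓡 m) e.symm x (EuclideanSpace.single i (1 : ℝ) : EuclideanSpace ℝ (Fin m))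

/-- The components `θᵢ = θ(∂ᵢ)` of a one-form in a chart, as functions of the coordinates. -/
def formComp (e : OpenPartialHomeomorph M (EuclideanSpace ℝ (Fin m))) (θ : Form m M)
    (x : EuclideanSpace ℝ (Fin m)) (i : Fin m) : ℝ :=
  θ (e.symm x) (coordVec e x i)

/-- The components `Tᵢⱼ = T(∂ᵢ, ∂ⱼ)` of a covariant two-tensor in a chart. -/
def tensorComp (e : OpenPartialHomeomorph M (EuclideanSpace ℝ (Fin m))) (T : Tensor2 m M)
    (x : EuclideanSpace ℝ (Fin m)) : Matrix (Fin m) (Fin m) ℝ :=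
  Matrix.of fun i j => T (e.symm x) (coordVec e x i) (coordVec e x j)

/-- The trace `trace_g T`, a function on `M`. It does not depend on the chart around `p` that is
used to compute it. -/
def traceTensor (g T : Tensor2 m M) (p : M) : ℝ :=
  let e := chartAt (EuclideanSpace ℝ (Fin m)) p
  matTrace (tensorComp e g (e p)) (tensorComp e T (e p))

/-- The traceless part `T - (1/m) (trace_g T) g`. -/
def tracelessPart (g T : Tensor2 m M) : Tensor2 m M :=
  fun p => T p - (traceTensor g T p / m) • g p

/-- TT-tensors: smooth symmetric covariant two-tensors that are trace free and divergence free. -/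
structure IsTT [IsManifold (𝓡 m) ∞ M] (g φ : Tensor2 m M) : Prop where
  smooth : SmoothTensor2 φ
  symm : ∀ p v w, φ p v w = φ p w v
  trace_eq_zero : ∀ p, traceTensor g φ p = 0
  div_eq_zero : ∀ e ∈ IsManifold.maximalAtlas (𝓡 m) ∞ M, ∀ x ∈ e.target, ∀ k,
    divTensor (tensorComp e g) (tensorComp e φ) x k = 0

/-- A smooth partition of unity subordinate to the cover by the preferred charts. -/
def chartPartition [IsManifold (𝓡 m) ∞ M] [T2Space M] [SigmaCompactSpace M] :
    SmoothPartitionOfUnity M (𝓡 m) M Set.univ :=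
  (SmoothPartitionOfUnity.exists_isSubordinate_chartAt_source (𝓡 m) M).choose

/-- The integral `∫_M u dvol_g` over a compact manifold with respect to the Riemannian volume
element, which is `√(det g) dx` in each chart. -/
def volIntegral [IsManifold (𝓡 m) ∞ M] [T2Space M] [CompactSpace M]
    (g : Tensor2 m M) (u : M → ℝ) : ℝ :=
  ∑ᶠ c : M,
    let e := chartAt (EuclideanSpace ℝ (Fin m)) c
    ∫ x in e.target, chartPartition (m := m) (M := M) c (e.symm x) * u (e.symm x) *
      Real.sqrt (tensorComp e g x).det

/-- The pointwise inner product `g(Sθ, φ)`, a function on `M`. It does not depend on the chart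
around `p` that is used to compute it. -/
def ahlforsInner (g : Tensor2 m M) (θ : Form m M) (φ : Tensor2 m M) (p : M) : ℝ :=
  let e := chartAt (EuclideanSpace ℝ (Fin m)) p
  matInner (tensorComp e g (e p)) (ahlfors (tensorComp e g) (formComp e θ) (e p))
    (tensorComp e φ (e p))

/-- `T = Sθ + φ` is an `L²`-orthogonal decomposition of `T`, with a smooth one-form `θ` and a
TT-tensor `φ`. The equation of tensors is written out in all charts of the smooth structure. -/
structure IsAhlforsDecomposition [IsManifold (𝓡 m) ∞ M] [T2Space M] [CompactSpace M]
    (g T : Tensor2 m M) (θ : Form m M) (φ : Tensor2 m M) : Prop where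
  smooth : SmoothForm θ
  isTT : IsTT g φ
  eq_add : ∀ e ∈ IsManifold.maximalAtlas (𝓡 m) ∞ M, ∀ x ∈ e.target,
    tensorComp e T x = ahlfors (tensorComp e g) (formComp e θ) x + tensorComp e φ x
  orthogonal : volIntegral g (ahlforsInner g θ φ) = 0

/-- The vacuum constraint equations (with zero cosmological constant) for `(M, g, K)`:
`s - g(K, K) + (trace_g K)² = 0` and `div_g K - d(trace_g K) = 0`, written out in all charts of
the smooth structure. -/
structure VacuumConstraints (g K : Tensor2 m M) : Prop where
  hamiltonian : ∀ e ∈ IsManifold.maximalAtlas (𝓡 m) ∞ M, ∀ x ∈ e.target,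
    scalarCurv (tensorComp e g) x
      - matInner (tensorComp e g x) (tensorComp e K x) (tensorComp e K x)
      + traceTensor g K (e.symm x) ^ 2 = 0
  momentum : ∀ e ∈ IsManifold.maximalAtlas (𝓡 m) ∞ M, ∀ x ∈ e.target, ∀ k,
    divTensor (tensorComp e g) (tensorComp e K) x k
      - pd k (fun y => traceTensor g K (e.symm y)) x = 0

end Manifold

/-! ### Lorentzian metrics and spacelike hypersurfaces -/

/-- A smooth Lorentzian metric of signature `(-, +, …, +)` on an `m`-dimensional manifold. -/
structure LorentzianMetric (m : ℕ) (L : Type*) [TopologicalSpace L]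
    [ChartedSpace (EuclideanSpace ℝ (Fin m)) L] [IsManifold (𝓡 m) ∞ L] where
  /-- The bilinear form on each tangent space. -/
  val : Tensor2 m L
  smooth : SmoothTensor2 val
  symm : ∀ q v w, val q v w = val q w v
  signature : ∀ q, ∃ v, val q v v < 0 ∧ ∀ w, val q v w = 0 → w ≠ 0 → 0 < val q w w

section Hypersurface

variable {n : ℕ} {M : Type*} [TopologicalSpace M] [ChartedSpace (EuclideanSpace ℝ (Fin n)) M]
  {L : Type*} [TopologicalSpace L] [ChartedSpace (EuclideanSpace ℝ (Fin (n + 1))) L]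
  [IsManifold (𝓡 (n + 1)) ∞ L]

/-- The induced metric `g = f* gL`. -/
def inducedMetric (gL : LorentzianMetric (n + 1) L) (f : M → L) : Tensor2 n M :=
  fun p =>
    let D : TangentSpace (𝓡 n) p →L[ℝ] TangentSpace (𝓡 (n + 1)) (f p) :=
      mfderiv (𝓡 n) (𝓡 (n + 1)) f p
    (ContinuousLinearMap.precomp ℝ D) ∘L gL.val (f p) ∘L D

/-- `f : M → L` is a smooth (immersed) spacelike hypersurface, that is, the induced metric is
positive definite, and `N` is a smooth timelike unit normal vector field along `f`. -/
structure IsSpacelikeHypersurface (gL : LorentzianMetric (n + 1) L) (f : M → L)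
    (N : ∀ p : M, TangentSpace (𝓡 (n + 1)) (f p)) : Prop where
  smooth : ContMDiff (𝓡 n) (𝓡 (n + 1)) ∞ f
  spacelike : ∀ p v, v ≠ 0 → 0 < inducedMetric gL f p v v
  smooth_normal : ContMDiff (𝓡 n) (𝓡 (n + 1)).tangent ∞
    (fun p => (⟨f p, N p⟩ : TangentBundle (𝓡 (n + 1)) L))
  unit : ∀ p, gL.val (f p) (N p) (N p) = -1
  normal : ∀ p v, gL.val (f p) (N p) (mfderiv (𝓡 n) (𝓡 (n + 1)) f p v) = 0

/-- The differential at `p` of the coordinate function `fᵃ` of `f` in the chart `e` of `L`. -/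
def dCoord (e : OpenPartialHomeomorph L (EuclideanSpace ℝ (Fin (n + 1)))) (f : M → L)
    (p : M) (a : Fin (n + 1)) : TangentSpace (𝓡 n) p →L[ℝ] ℝ :=
  mvfderiv (𝓡 n) (fun q => e (f q) a) p

/-- The component `Nᵃ` in the chart `e` of `L` of a vector field `N` along `f`. -/
def vecComp (e : OpenPartialHomeomorph L (EuclideanSpace ℝ (Fin (n + 1)))) (f : M → L)
    (N : ∀ p : M, TangentSpace (𝓡 (n + 1)) (f p)) (a : Fin (n + 1)) (p : M) : ℝ :=
  (mvfderiv (𝓡 (n + 1)) e (f p) (N p)) a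

/-- The component `v ↦ (∇_v N)ᵃ = dNᵃ(v) + Γᵃ_bc dfᵇ(v) Nᶜ` in the chart `e` of `L` of the
covariant derivative of a vector field `N` along `f`, with respect to the Levi-Civita connection
of `L`. -/
def covDerivAlong (gL : LorentzianMetric (n + 1) L)
    (e : OpenPartialHomeomorph L (EuclideanSpace ℝ (Fin (n + 1)))) (f : M → L)
    (N : ∀ p : M, TangentSpace (𝓡 (n + 1)) (f p)) (p : M) (a : Fin (n + 1)) :
    TangentSpace (𝓡 n) p →L[ℝ] ℝ :=
  mvfderiv (𝓡 n) (vecComp e f N a) p +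
    ∑ b, ∑ c, (christoffel (tensorComp e gL.val) (e (f p)) a b c * vecComp e f N c p) •
      dCoord e f p b

/-- The second fundamental form `K(v, w) = gL(∇_v N, df w)` of the hypersurface `f` with unit
normal `N`. It does not depend on the chart around `f p` that is used to compute it. -/
def secondFundamentalForm (gL : LorentzianMetric (n + 1) L) (f : M → L)
    (N : ∀ p : M, TangentSpace (𝓡 (n + 1)) (f p)) : Tensor2 n M := fun p =>
  let e := chartAt (EuclideanSpace ℝ (Fin (n + 1))) (f p)
  ∑ a, ∑ b, tensorComp e gL.val (e (f p)) a b •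
    (covDerivAlong gL e f N p a).smulRight (dCoord e f p b)

/-- The mean curvature `H = trace_g K`, with respect to the induced metric. -/
def meanCurvature (gL : LorentzianMetric (n + 1) L) (f : M → L)
    (N : ∀ p : M, TangentSpace (𝓡 (n + 1)) (f p)) (p : M) : ℝ :=
  traceTensor (inducedMetric gL f) (secondFundamentalForm gL f N) p

end Hypersurface

end AhlforsVacuum

end

open AhlforsVacuum

/-!
Write `g` for the induced metric, `H = trace_g K`, and `T = K₀ - φ`, which in every chart is the
Cauchy-Ahlfors tensor `Sθ`.

If `H` is constant, then the momentum constraint `div K = dH` says that `K` is divergence-free, and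
then so is `T = K - (H/n) g - φ`. For a trace-free symmetric `T = Sθ` the divergence of the vector
field `X` dual to `T(θ♯, ·)` is `(div T)(θ♯) + g(T, ∇θ) = g(T, Sθ)`, so here it is `|T|²`. By the
divergence theorem on the compact manifold `M`, `∫ |T|² = 0`, and `T = 0`
(`IsDivFreeAhlfors.tensorComp_eq_zero`). As integration on Riemannian manifolds is not in Mathlib,
the divergence theorem is proved for `X`: integrals over charts are cut off by a partition of unity,
integrated by parts in `ℝⁿ`, and compared by the change of variables formula. The identity
`∂ᵢ (√det G Xⁱ) = |T|² √det G` in coordinates is `IsMetricAt.sum_pd_sqrt_det_mul`.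

Conversely, if `K = (H/n) g + φ`, then the momentum constraint reads `(1/n) dH = dH`, so `dH = 0`
and `H` is constant on the connected manifold `M` (`exists_trace_eq_const`).

This last step requires `H` to be differentiable. The definition of `K` at `p` uses the preferred
chart around `f p`, which varies with `p` in an uncontrolled way. So smoothness of `K` rests on the
fact that every chart of the ambient manifold gives the same `K`
(`IsSpacelikeHypersurface.sffIn_eq_sffIn`). It is proved from the Koszul formula for `g(∇_V N, W)`,
which contains no inverse of the metric: its change under a change of coordinates follows from
differentiating the transformation law of the metric and the symmetry of second derivatives.
-/

open Filter Topology

namespace AhlforsVacuum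

/-! ### Traces and inner products of two-tensors -/

section LinearAlgebra

variable {m : ℕ}

lemma matTrace_eq_trace (G A : Matrix (Fin m) (Fin m) ℝ) :
    matTrace G A = (G⁻¹ * Aᵀ).trace := by
  simp [matTrace, Matrix.trace, Matrix.mul_apply]

lemma matInner_eq_trace (G A B : Matrix (Fin m) (Fin m) ℝ) :
    matInner G A B = (Aᵀ * G⁻¹ * B * G⁻¹ᵀ).trace := by
  simp only [matInner, Matrix.trace, Matrix.mul_apply, Matrix.diag_apply, Matrix.transpose_apply,
    Finset.sum_mul]
  rw [Finset.sum_comm]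
  refine Finset.sum_congr rfl fun j _ => ?_
  rw [Finset.sum_comm' (t' := Finset.univ) (s' := fun _ => Finset.univ) (by simp)]
  calc _ = ∑ k, ∑ l, ∑ i, A i j * G⁻¹ i k * B k l * G⁻¹ j l := by
        refine Finset.sum_congr rfl fun k _ => ?_
        rw [Finset.sum_comm]
        exact Finset.sum_congr rfl fun l _ => Finset.sum_congr rfl fun i _ => by ring
    _ = _ := Finset.sum_comm

/-- The trace does not depend on the basis in which the components are taken. -/
lemma matTrace_congr (G A J : Matrix (Fin m) (Fin m) ℝ) (hJ : IsUnit J.det) :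
    matTrace (Jᵀ * G * J) (Jᵀ * A * J) = matTrace G A := by
  rw [matTrace_eq_trace, matTrace_eq_trace, Matrix.mul_inv_rev, Matrix.mul_inv_rev,
    Matrix.transpose_mul, Matrix.transpose_mul, Matrix.transpose_transpose]
  have hJ' : IsUnit Jᵀ.det := by rwa [Matrix.det_transpose]
  calc _ = (J⁻¹ * (G⁻¹ * (Jᵀ⁻¹ * Jᵀ) * (Aᵀ * J))).trace := by simp only [Matrix.mul_assoc]
    _ = _ := by
      rw [Matrix.nonsing_inv_mul _ hJ', Matrix.mul_one, Matrix.trace_mul_comm, Matrix.mul_assoc,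
        Matrix.mul_assoc, Matrix.mul_nonsing_inv _ hJ, Matrix.mul_one]

/-- The inner product does not depend on the basis in which the components are taken. -/
lemma matInner_congr (G A B J : Matrix (Fin m) (Fin m) ℝ) (hJ : IsUnit J.det) :
    matInner (Jᵀ * G * J) (Jᵀ * A * J) (Jᵀ * B * J) = matInner G A B := by
  have hJ' : IsUnit Jᵀ.det := by rwa [Matrix.det_transpose]
  rw [matInner_eq_trace, matInner_eq_trace, Matrix.mul_inv_rev, Matrix.mul_inv_rev]
  simp only [Matrix.transpose_mul, Matrix.transpose_transpose]
  calc _ = (Jᵀ * (Aᵀ * (J * J⁻¹) * G⁻¹ * (Jᵀ⁻¹ * Jᵀ) * B * (J * (Jᵀ⁻¹)ᵀ) * G⁻¹ᵀ * J⁻¹ᵀ)).trace := by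
        simp only [Matrix.mul_assoc]
    _ = _ := by
      rw [Matrix.trace_mul_comm, Matrix.transpose_nonsing_inv Jᵀ, Matrix.transpose_transpose,
        Matrix.transpose_nonsing_inv J, Matrix.mul_assoc _ (Jᵀ⁻¹) Jᵀ,
        Matrix.nonsing_inv_mul _ hJ', Matrix.mul_nonsing_inv _ hJ]
      simp only [Matrix.mul_one]

open scoped MatrixOrder in
lemma matInner_self_eq_sum_sq {G S : Matrix (Fin m) (Fin m) ℝ} (hG : G.PosDef) :
    ∃ B : Matrix (Fin m) (Fin m) ℝ, IsUnit B.det ∧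
      matInner G S S = ∑ j, ∑ i, (B * S * Bᵀ) i j ^ 2 := by
  obtain ⟨B, hB⟩ := CStarAlgebra.nonneg_iff_eq_star_mul_self.1 hG.inv.posSemidef.nonneg
  rw [Matrix.star_eq_conjTranspose, Matrix.conjTranspose_eq_transpose_of_trivial] at hB
  refine ⟨B, ?_, ?_⟩
  · have h := hG.inv.det_pos
    rw [hB, Matrix.det_mul, Matrix.det_transpose] at h
    exact isUnit_iff_ne_zero.2 fun h0 => by simp [h0] at h
  · rw [matInner_eq_trace, hB, Matrix.transpose_mul, Matrix.transpose_transpose,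
      ← Matrix.mul_assoc, Matrix.trace_mul_comm]
    have : B * (Sᵀ * (Bᵀ * B) * S * Bᵀ) = (B * S * Bᵀ)ᵀ * (B * S * Bᵀ) := by
      simp only [Matrix.transpose_mul, Matrix.transpose_transpose, Matrix.mul_assoc]
    rw [this]
    generalize B * S * Bᵀ = C
    simp [Matrix.trace, Matrix.mul_apply, sq]

lemma matInner_self_nonneg {G S : Matrix (Fin m) (Fin m) ℝ} (hG : G.PosDef) :
    0 ≤ matInner G S S := by
  obtain ⟨B, -, h⟩ := matInner_self_eq_sum_sq (S := S) hG
  rw [h]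
  positivity

lemma eq_zero_of_matInner_self_eq_zero {G S : Matrix (Fin m) (Fin m) ℝ} (hG : G.PosDef)
    (h0 : matInner G S S = 0) : S = 0 := by
  obtain ⟨B, hB, h⟩ := matInner_self_eq_sum_sq (S := S) hG
  have hz : B * S * Bᵀ = 0 := by
    ext i j
    rw [h, Finset.sum_eq_zero_iff_of_nonneg fun _ _ => by positivity] at h0
    have := (Finset.sum_eq_zero_iff_of_nonneg fun _ _ => by positivity).1
      (h0 j (Finset.mem_univ j)) i (Finset.mem_univ i)
    simpa using this
  have hB' : IsUnit Bᵀ.det := by rwa [Matrix.det_transpose]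
  calc S = B⁻¹ * (B * S * Bᵀ) * Bᵀ⁻¹ := by
        rw [← Matrix.mul_assoc, ← Matrix.mul_assoc, Matrix.nonsing_inv_mul _ hB, Matrix.one_mul,
          Matrix.mul_assoc, Matrix.mul_nonsing_inv _ hB', Matrix.mul_one]
    _ = 0 := by rw [hz]; simp

/-- Pairing `r ⊗ t` with `S` is pairing `r` with the vector `(S t♯)♯`. -/
lemma matInner_vecMulVec {G : Matrix (Fin m) (Fin m) ℝ} (hG : G.IsSymm) (r t : Fin m → ℝ)
    (S : Matrix (Fin m) (Fin m) ℝ) :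
    matInner G (Matrix.vecMulVec r t) S = ∑ i, r i * (G⁻¹ *ᵥ (S *ᵥ (G⁻¹ *ᵥ t))) i := by
  have hs : ∀ i j, G⁻¹ i j = G⁻¹ j i := fun i j => by
    rw [← Matrix.transpose_apply G⁻¹, Matrix.transpose_nonsing_inv, hG.eq]
  simp only [matInner, Matrix.mulVec, dotProduct, Matrix.vecMulVec_apply, Finset.mul_sum]
  refine Finset.sum_congr rfl fun i _ => ?_
  rw [Finset.sum_comm]
  refine Finset.sum_congr rfl fun k _ => ?_
  rw [Finset.sum_comm]
  refine Finset.sum_congr rfl fun l _ => Finset.sum_congr rfl fun j _ => ?_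
  rw [hs j l]
  ring

end LinearAlgebra

/-! ### Coordinate calculus with matrix-valued functions -/

section Calculus

variable {m : ℕ}

local notation "E" => EuclideanSpace ℝ (Fin m)

/-- The matrix of `i`-th partial derivatives of the entries of `A`. -/
noncomputable def pdMat (i : Fin m) (A : E → Matrix (Fin m) (Fin m) ℝ) (x : E) :
    Matrix (Fin m) (Fin m) ℝ :=
  Matrix.of fun j k => pd i (fun y => A y j k) x

/-- The vector of `i`-th partial derivatives of the entries of `v`. -/
noncomputable def pdVec (i : Fin m) (v : E → Fin m → ℝ) (x : E) : Fin m → ℝ :=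
  fun j => pd i (fun y => v y j) x

/-- Entrywise differentiability at `x`. -/
def DiffMat (A : E → Matrix (Fin m) (Fin m) ℝ) (x : E) : Prop :=
  ∀ j k, DifferentiableAt ℝ (fun y => A y j k) x

/-- Entrywise smoothness at `x`. -/
def SmoothMat (A : E → Matrix (Fin m) (Fin m) ℝ) (x : E) : Prop :=
  ∀ j k, ContDiffAt ℝ ∞ (fun y => A y j k) x

lemma SmoothMat.diffMat {A : E → Matrix (Fin m) (Fin m) ℝ} {x : E} (h : SmoothMat A x) :
    DiffMat A x := fun j k => (h j k).differentiableAt (by simp)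

lemma pd_congr {i : Fin m} {u v : E → ℝ} {x : E} (h : u =ᶠ[𝓝 x] v) : pd i u x = pd i v x := by
  rw [pd, pd, h.fderiv_eq]

lemma pd_add {i : Fin m} {u v : E → ℝ} {x : E} (hu : DifferentiableAt ℝ u x)
    (hv : DifferentiableAt ℝ v x) : pd i (fun y => u y + v y) x = pd i u x + pd i v x := by
  simp [pd, fderiv_fun_add hu hv]

lemma pd_mul {i : Fin m} {u v : E → ℝ} {x : E} (hu : DifferentiableAt ℝ u x)
    (hv : DifferentiableAt ℝ v x) :
    pd i (fun y => u y * v y) x = pd i u x * v x + u x * pd i v x := by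
  simp [pd, fderiv_fun_mul hu hv]
  ring

lemma pd_sum {ι : Type*} {s : Finset ι} {i : Fin m} {u : ι → E → ℝ} {x : E}
    (hu : ∀ a ∈ s, DifferentiableAt ℝ (u a) x) :
    pd i (fun y => ∑ a ∈ s, u a y) x = ∑ a ∈ s, pd i (u a) x := by
  simp [pd, fderiv_fun_sum hu]

lemma pd_const (i : Fin m) (c : ℝ) (x : E) : pd i (fun _ => c) x = 0 := by
  simp [pd]

lemma ContDiffAt.pd {u : E → ℝ} {x : E} (i : Fin m) (h : ContDiffAt ℝ ∞ u x) :
    ContDiffAt ℝ ∞ (fun y => AhlforsVacuum.pd i u y) x :=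
  (h.fderiv_right (m := ∞) (by simp)).clm_apply contDiffAt_const

lemma pdMat_mul {i : Fin m} {A B : E → Matrix (Fin m) (Fin m) ℝ} {x : E} (hA : DiffMat A x)
    (hB : DiffMat B x) :
    pdMat i (fun y => A y * B y) x = pdMat i A x * B x + A x * pdMat i B x := by
  ext j k
  simp only [pdMat, Matrix.of_apply, Matrix.mul_apply, Matrix.add_apply]
  rw [pd_sum fun a _ => (hA j a).fun_mul (hB a k), ← Finset.sum_add_distrib]
  exact Finset.sum_congr rfl fun a _ => pd_mul (hA j a) (hB a k)

lemma pdVec_mulVec {i : Fin m} {A : E → Matrix (Fin m) (Fin m) ℝ} {v : E → Fin m → ℝ} {x : E}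
    (hA : DiffMat A x) (hv : ∀ j, DifferentiableAt ℝ (fun y => v y j) x) :
    pdVec i (fun y => A y *ᵥ v y) x = pdMat i A x *ᵥ v x + A x *ᵥ pdVec i v x := by
  ext j
  simp only [pdVec, pdMat, Matrix.mulVec, dotProduct, Pi.add_apply, Matrix.of_apply]
  rw [pd_sum fun a _ => (hA j a).fun_mul (hv a), ← Finset.sum_add_distrib]
  exact Finset.sum_congr rfl fun a _ => pd_mul (hA j a) (hv a)

lemma contDiffAt_mulVec {A : E → Matrix (Fin m) (Fin m) ℝ} {v : E → Fin m → ℝ} {x : E}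
    (hA : SmoothMat A x) (hv : ∀ j, ContDiffAt ℝ ∞ (fun y => v y j) x) (j : Fin m) :
    ContDiffAt ℝ ∞ (fun y => (A y *ᵥ v y) j) x := by
  simp only [Matrix.mulVec, dotProduct]
  exact ContDiffAt.sum fun a _ => (hA j a).mul (hv a)

lemma contDiffAt_det {n : WithTop ℕ∞} {F : Type*} [NormedAddCommGroup F] [NormedSpace ℝ F]
    {A : F → Matrix (Fin m) (Fin m) ℝ} {x : F}
    (hA : ∀ j k, ContDiffAt ℝ n (fun y => A y j k) x) :
    ContDiffAt ℝ n (fun y => (A y).det) x := by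
  simp only [Matrix.det_apply]
  exact ContDiffAt.sum fun σ _ => (contDiffAt_prod fun j _ => hA _ _).const_smul _

lemma SmoothMat.inv {A : E → Matrix (Fin m) (Fin m) ℝ} {x : E} (hA : SmoothMat A x)
    (h : (A x).det ≠ 0) : SmoothMat (fun y => (A y)⁻¹) x := by
  intro j k
  -- Cramer's rule.
  have : (fun y => (A y)⁻¹ j k) =
      fun y => (A y).det⁻¹ * ((A y).updateRow k (Pi.single j 1)).det := by
    ext y
    rw [Matrix.inv_def, Matrix.smul_apply, Matrix.adjugate_apply, smul_eq_mul, Ring.inverse_eq_inv']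
  rw [this]
  refine ((contDiffAt_det hA).inv h).mul (contDiffAt_det fun a b => ?_)
  by_cases hak : a = k
  · subst hak
    simpa using contDiffAt_const
  · simpa [hak] using hA a b

lemma pdMat_inv {i : Fin m} {A : E → Matrix (Fin m) (Fin m) ℝ} {x : E} (hA : SmoothMat A x)
    (h : (A x).det ≠ 0) :
    pdMat i (fun y => (A y)⁻¹) x = -((A x)⁻¹ * pdMat i A x * (A x)⁻¹) := by
  have h1 := pdMat_mul (i := i) (hA.inv h).diffMat hA.diffMat
  have hev : ∀ᶠ y in 𝓝 x, (A y).det ≠ 0 :=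
    (contDiffAt_det hA).continuousAt.eventually_ne h
  have h2 : pdMat i (fun y => (A y)⁻¹ * A y) x = 0 := by
    ext j k
    refine (pd_congr (v := fun _ => (1 : Matrix (Fin m) (Fin m) ℝ) j k) ?_).trans (pd_const _ _ _)
    filter_upwards [hev] with y hy
    rw [Matrix.nonsing_inv_mul _ (isUnit_iff_ne_zero.2 hy)]
  rw [h2] at h1
  calc _ = pdMat i (fun y => (A y)⁻¹) x * (A x * (A x)⁻¹) := by
        rw [Matrix.mul_nonsing_inv _ (isUnit_iff_ne_zero.2 h), Matrix.mul_one]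
    _ = _ := by
        rw [← Matrix.mul_assoc, eq_neg_of_add_eq_zero_left h1.symm, Matrix.neg_mul]

/-- **Jacobi's formula** along a line: from the first-order expansion of
`det (1 + r A⁻¹P)` in `r`. -/
lemma hasDerivAt_det_add_smul (A P : Matrix (Fin m) (Fin m) ℝ) (h : A.det ≠ 0) :
    HasDerivAt (fun r : ℝ => (A + r • P).det) (A.det * (A⁻¹ * P).trace) 0 := by
  have hfac : (fun r : ℝ => (A + r • P).det) = fun r => A.det * (1 + r • (A⁻¹ * P)).det := by
    ext r
    rw [← Matrix.det_mul, Matrix.mul_add, Matrix.mul_one, Matrix.mul_smul, ← Matrix.mul_assoc,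
      Matrix.mul_nonsing_inv _ (isUnit_iff_ne_zero.2 h), Matrix.one_mul]
  rw [hfac]
  refine HasDerivAt.const_mul _ ?_
  have hexp := fun r : ℝ => Matrix.det_one_add_smul r (A⁻¹ * P)
  -- The remainder of the expansion is `r²` times a polynomial `q` in `r`.
  generalize (Matrix.det (1 + (Polynomial.X : Polynomial ℝ) •
    (A⁻¹ * P).map Polynomial.C)).divX.divX = q at hexp
  rw [funext hexp]
  have h1 := ((hasDerivAt_id (0 : ℝ)).const_mul (A⁻¹ * P).trace).const_add 1
  have h2 := h1.add ((q.hasDerivAt 0).mul ((hasDerivAt_id (0 : ℝ)).pow 2))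
  convert! h2 using 1
  simp

/-- **Jacobi's formula**. -/
lemma pd_det {i : Fin m} {A : E → Matrix (Fin m) (Fin m) ℝ} {x : E} (hA : DiffMat A x)
    (h : (A x).det ≠ 0) :
    pd i (fun y => (A y).det) x = (A x).det * ((A x)⁻¹ * pdMat i A x).trace := by
  set d : (Fin m → Fin m → ℝ) → ℝ := fun B => (Matrix.of B).det
  set A' : E → Fin m → Fin m → ℝ := fun y j k => A y j k
  have hd : DifferentiableAt ℝ d (A' x) := by
    refine ContDiffAt.differentiableAt (n := 1) (contDiffAt_det fun j k => ?_) one_ne_zero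
    exact (contDiff_apply_apply ℝ ℝ j k).contDiffAt
  have hA' : HasFDerivAt A' (ContinuousLinearMap.pi fun j => ContinuousLinearMap.pi fun k =>
      fderiv ℝ (fun y => A y j k) x) x :=
    hasFDerivAt_pi.2 fun j => hasFDerivAt_pi.2 fun k => (hA j k).hasFDerivAt
  have hcomp := (hd.hasFDerivAt.comp x hA').fderiv
  -- The derivative of `det` at `A x` in the direction `∂ᵢA` is computed along a line.
  set P : Fin m → Fin m → ℝ := fun j k => pd i (fun y => A y j k) x
  have hline : HasDerivAt (fun r : ℝ => d (A' x + r • P)) (fderiv ℝ d (A' x) P) 0 := by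
    have h0 : HasDerivAt (fun r : ℝ => A' x + r • P) P 0 := by
      simpa using ((hasDerivAt_id (0 : ℝ)).smul_const P).const_add (A' x)
    refine HasFDerivAt.comp_hasDerivAt (0 : ℝ) ?_ h0
    rw [zero_smul, add_zero]
    exact hd.hasFDerivAt
  refine Eq.trans ?_ (hline.unique (hasDerivAt_det_add_smul (A x) (pdMat i A x) h))
  change (fderiv ℝ (d ∘ A') x) _ = _
  rw [hcomp]
  rfl

end Calculus

/-! ### The Cauchy-Ahlfors operator in coordinates -/

section Coordinates

variable {m : ℕ}

local notation "E" => EuclideanSpace ℝ (Fin m)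

/-- The matrix `Γᵏᵢⱼ` of Christoffel symbols with `i` fixed, rows `k` and columns `j`. -/
noncomputable def christoffelMat (G : E → Matrix (Fin m) (Fin m) ℝ) (x : E) (i : Fin m) :
    Matrix (Fin m) (Fin m) ℝ :=
  Matrix.of fun k j => christoffel G x k i j

/-- `G` is the matrix of a smooth metric near `x`: smooth and of positive determinant at `x`, symmetric
in a neighbourhood of `x` (so that partial derivatives at `x` are symmetric as well). -/
structure IsMetricAt (G : E → Matrix (Fin m) (Fin m) ℝ) (x : E) : Prop where
  smooth : SmoothMat G x
  symm : ∀ᶠ y in 𝓝 x, (G y).IsSymm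
  det_pos : 0 < (G x).det

variable {G : EuclideanSpace ℝ (Fin m) → Matrix (Fin m) (Fin m) ℝ} {x : EuclideanSpace ℝ (Fin m)}

/-- The Christoffel symbols with lowered index. -/
lemma mul_christoffelMat (hG : IsUnit (G x).det) (i l j : Fin m) :
    (G x * christoffelMat G x i) l j = (1 / 2) *
      (pd i (fun y => G y j l) x + pd j (fun y => G y i l) x - pd l (fun y => G y i j) x) := by
  have h : christoffelMat G x i = (G x)⁻¹ * Matrix.of fun l j => (1 / 2) *
      (pd i (fun y => G y j l) x + pd j (fun y => G y i l) x - pd l (fun y => G y i j) x) := by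
    ext k j
    simp only [christoffelMat, christoffel, Matrix.of_apply, Matrix.mul_apply, Finset.mul_sum]
    exact Finset.sum_congr rfl fun l _ => by ring
  rw [h, ← Matrix.mul_assoc, Matrix.mul_nonsing_inv _ hG, Matrix.one_mul,
    Matrix.of_apply]

namespace IsMetricAt

lemma isUnit_det (hG : IsMetricAt G x) : IsUnit (G x).det :=
  isUnit_iff_ne_zero.2 hG.det_pos.ne'

lemma pd_symm (hG : IsMetricAt G x) (i j k : Fin m) :
    pd i (fun y => G y j k) x = pd i (fun y => G y k j) x :=
  pd_congr (hG.symm.mono fun _ hy => hy.apply k j)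

lemma inv_symm (hG : IsMetricAt G x) : (G x)⁻¹.IsSymm := by
  rw [Matrix.IsSymm, Matrix.transpose_nonsing_inv, hG.symm.self_of_nhds.eq]

lemma christoffel_symm (hG : IsMetricAt G x) (k i j : Fin m) :
    christoffel G x k i j = christoffel G x k j i := by
  simp only [christoffel]
  congr 1
  refine Finset.sum_congr rfl fun l _ => ?_
  rw [hG.pd_symm l i j]
  ring

/-- The Levi-Civita connection is compatible with the metric. -/
lemma pdMat_eq (hG : IsMetricAt G x) (i : Fin m) :
    pdMat i G x = G x * christoffelMat G x i + (christoffelMat G x i)ᵀ * G x := by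
  have h : (christoffelMat G x i)ᵀ * G x = (G x * christoffelMat G x i)ᵀ := by
    rw [Matrix.transpose_mul, hG.symm.self_of_nhds.eq]
  ext j k
  rw [h, Matrix.add_apply, Matrix.transpose_apply, mul_christoffelMat hG.isUnit_det,
    mul_christoffelMat hG.isUnit_det, pdMat, Matrix.of_apply, hG.pd_symm i k j]
  ring

lemma pdMat_inv_eq (hG : IsMetricAt G x) (i : Fin m) :
    pdMat i (fun y => (G y)⁻¹) x =
      -(christoffelMat G x i * (G x)⁻¹ + (G x)⁻¹ * (christoffelMat G x i)ᵀ) := by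
  rw [pdMat_inv hG.smooth hG.det_pos.ne', hG.pdMat_eq, Matrix.mul_add, Matrix.add_mul,
    ← Matrix.mul_assoc, Matrix.nonsing_inv_mul _ hG.isUnit_det, Matrix.one_mul,
    Matrix.mul_assoc _ _ (G x)⁻¹, Matrix.mul_assoc _ (G x), Matrix.mul_nonsing_inv _ hG.isUnit_det,
    Matrix.mul_one]

lemma pd_sqrt_det (hG : IsMetricAt G x) (i : Fin m) :
    pd i (fun y => √(G y).det) x = √(G x).det * (christoffelMat G x i).trace := by
  have h1 : ((G x)⁻¹ * pdMat i G x).trace = 2 * (christoffelMat G x i).trace := by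
    rw [hG.pdMat_eq, Matrix.mul_add, Matrix.trace_add, ← Matrix.mul_assoc,
      Matrix.nonsing_inv_mul _ hG.isUnit_det, Matrix.one_mul, Matrix.trace_mul_comm,
      Matrix.mul_assoc, Matrix.mul_nonsing_inv _ hG.isUnit_det, Matrix.mul_one,
      Matrix.trace_transpose]
    ring
  have h2 : pd i (fun y => √(G y).det) x = 1 / (2 * √(G x).det) * pd i (fun y => (G y).det) x := by
    have hd : DifferentiableAt ℝ (fun y => (G y).det) x :=
      (contDiffAt_det hG.smooth).differentiableAt (by simp)
    simp [pd, (hd.hasFDerivAt.sqrt hG.det_pos.ne').fderiv]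
  have hs : √(G x).det ≠ 0 := (Real.sqrt_pos.2 hG.det_pos).ne'
  rw [h2, pd_det hG.smooth.diffMat hG.det_pos.ne', h1]
  field_simp
  rw [Real.sq_sqrt hG.det_pos.le]

lemma covDerivForm_eq (t : E → Fin m → ℝ) (i : Fin m) :
    covDerivForm G t x i = pdVec i t x - (christoffelMat G x i)ᵀ *ᵥ t x := by
  ext j
  simp [covDerivForm, pdVec, christoffelMat, Matrix.mulVec, dotProduct]

lemma covDerivTensor_eq (A : E → Matrix (Fin m) (Fin m) ℝ) (i : Fin m) :
    Matrix.of (covDerivTensor G A x i) =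
      pdMat i A x - (christoffelMat G x i)ᵀ * A x - A x * christoffelMat G x i := by
  ext j k
  simp only [covDerivTensor, pdMat, christoffelMat, Matrix.of_apply, Matrix.sub_apply,
    Matrix.mul_apply, Matrix.transpose_apply, Finset.sum_add_distrib]
  rw [sub_sub]
  congr 2
  exact Finset.sum_congr rfl fun l _ => mul_comm _ _

/-- `L_ξ g` is twice the symmetrised covariant derivative of the one-form dual to `ξ`. -/
lemma lieMetric_eq (hG : IsMetricAt G x) {t : E → Fin m → ℝ}
    (ht : ∀ j, ContDiffAt ℝ ∞ (fun y => t y j) x) (i j : Fin m) :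
    lieMetric G (sharp G t) x i j = covDerivForm G t x i j + covDerivForm G t x j i := by
  set ξ := sharp G t
  have hξ : ∀ k, DifferentiableAt ℝ (fun y => ξ y k) x := fun k =>
    (contDiffAt_mulVec (hG.smooth.inv hG.det_pos.ne') ht k).differentiableAt (by simp)
  have hev : ∀ᶠ y in 𝓝 x, t y = G y *ᵥ ξ y := by
    filter_upwards [(contDiffAt_det hG.smooth).continuousAt.eventually_ne hG.det_pos.ne'] with y hy
    change t y = G y *ᵥ ((G y)⁻¹ *ᵥ t y)
    rw [Matrix.mulVec_mulVec, Matrix.mul_nonsing_inv _ (isUnit_iff_ne_zero.2 hy),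
      Matrix.one_mulVec]
  have hpd : ∀ i, pdVec i t x = pdMat i G x *ᵥ ξ x + G x *ᵥ pdVec i ξ x := fun i => by
    rw [← pdVec_mulVec hG.smooth.diffMat hξ]
    ext j
    exact pd_congr (hev.mono fun y hy => congrFun hy j)
  have hΓ : ∀ i, (christoffelMat G x i)ᵀ *ᵥ t x = (G x * christoffelMat G x i)ᵀ *ᵥ ξ x := fun i => by
    rw [hev.self_of_nhds, Matrix.mulVec_mulVec, Matrix.transpose_mul, hG.symm.self_of_nhds.eq]
  rw [covDerivForm_eq, covDerivForm_eq, hΓ, hΓ, hpd, hpd]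
  simp only [lieMetric, Pi.sub_apply, Pi.add_apply, Matrix.mulVec, dotProduct,
    Matrix.transpose_apply, mul_christoffelMat hG.isUnit_det, pdMat, Matrix.of_apply, pdVec,
    ← Finset.sum_add_distrib, ← Finset.sum_sub_distrib]
  refine Finset.sum_congr rfl fun k _ => ?_
  rw [hG.pd_symm k j i, hG.symm.self_of_nhds.apply j k]
  ring

lemma ahlfors_eq (hG : IsMetricAt G x) {t : E → Fin m → ℝ}
    (ht : ∀ j, ContDiffAt ℝ ∞ (fun y => t y j) x) (i j : Fin m) :
    ahlfors G t x i j = (1 / 2) * (covDerivForm G t x i j + covDerivForm G t x j i) +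
      (1 / (m : ℝ)) * codiff G t x * G x i j := by
  rw [ahlfors, Matrix.of_apply, hG.lieMetric_eq ht]

lemma ahlfors_isSymm (hG : IsMetricAt G x) {t : E → Fin m → ℝ}
    (ht : ∀ j, ContDiffAt ℝ ∞ (fun y => t y j) x) : (ahlfors G t x).IsSymm := by
  refine Matrix.IsSymm.ext fun i j => ?_
  rw [hG.ahlfors_eq ht, hG.ahlfors_eq ht, hG.symm.self_of_nhds.apply]
  ring

lemma matTrace_self (hG : IsMetricAt G x) : matTrace (G x) (G x) = m := by
  rw [matTrace_eq_trace, hG.symm.self_of_nhds.eq, Matrix.nonsing_inv_mul _ hG.isUnit_det,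
    Matrix.trace_one, Fintype.card_fin]

/-- The trace of the Cauchy-Ahlfors operator vanishes. -/
lemma matTrace_ahlfors (hG : IsMetricAt G x) (hm : m ≠ 0) {t : E → Fin m → ℝ}
    (ht : ∀ j, ContDiffAt ℝ ∞ (fun y => t y j) x) : matTrace (G x) (ahlfors G t x) = 0 := by
  have h1 : ∑ i, ∑ j, (G x)⁻¹ i j * covDerivForm G t x j i =
      ∑ i, ∑ j, (G x)⁻¹ i j * covDerivForm G t x i j := by
    rw [Finset.sum_comm]
    exact Finset.sum_congr rfl fun i _ => Finset.sum_congr rfl fun j _ => by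
      rw [hG.inv_symm.apply]
  calc matTrace (G x) (ahlfors G t x)
      = (1 / 2) * (∑ i, ∑ j, (G x)⁻¹ i j * covDerivForm G t x i j +
          ∑ i, ∑ j, (G x)⁻¹ i j * covDerivForm G t x j i) +
          (1 / (m : ℝ)) * codiff G t x * matTrace (G x) (G x) := by
        simp only [matTrace, hG.ahlfors_eq ht, Finset.mul_sum, ← Finset.sum_add_distrib]
        exact Finset.sum_congr rfl fun i _ => Finset.sum_congr rfl fun j _ => by ring
    _ = 0 := by
        rw [h1, hG.matTrace_self, codiff]
        field_simp
        ring

/-- `∑ᵢⱼ (g⁻¹ S g⁻¹)ⁱʲ ∇ᵢtⱼ = |S|²` for `S` the Cauchy-Ahlfors operator of `t`: contracting the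
symmetric trace-free `S` with `∇t` only sees the symmetric trace-free part of `∇t`. -/
lemma sum_mul_covDerivForm (hG : IsMetricAt G x) (hm : m ≠ 0) {t : E → Fin m → ℝ}
    (ht : ∀ j, ContDiffAt ℝ ∞ (fun y => t y j) x) :
    ∑ i, ∑ j, ((G x)⁻¹ * ahlfors G t x * (G x)⁻¹) i j * covDerivForm G t x i j =
      matInner (G x) (ahlfors G t x) (ahlfors G t x) := by
  set S := ahlfors G t x
  have hS : S.IsSymm := hG.ahlfors_isSymm ht
  set P := (G x)⁻¹ * S * (G x)⁻¹
  have hP : P.IsSymm := by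
    simp only [P, Matrix.IsSymm, Matrix.transpose_mul, hS.eq, hG.inv_symm.eq, Matrix.mul_assoc]
  have h1 : ∑ i, ∑ j, P i j * covDerivForm G t x j i =
      ∑ i, ∑ j, P i j * covDerivForm G t x i j := by
    rw [Finset.sum_comm]
    exact Finset.sum_congr rfl fun i _ => Finset.sum_congr rfl fun j _ => by rw [hP.apply]
  have h2 : ∑ i, ∑ j, P i j * G x i j = 0 := by
    rw [← hG.matTrace_ahlfors hm ht, matTrace_eq_trace, hS.eq]
    calc _ = (P * (G x)ᵀ).trace := by simp [Matrix.trace, Matrix.mul_apply]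
      _ = _ := by
        rw [hG.symm.self_of_nhds.eq, Matrix.mul_assoc, Matrix.nonsing_inv_mul _ hG.isUnit_det,
          Matrix.mul_one]
  have h3 : matInner (G x) S S = ∑ i, ∑ j, P i j * S i j := by
    rw [matInner_eq_trace, hS.eq, hG.inv_symm.eq, Matrix.mul_assoc, Matrix.mul_assoc,
      Matrix.trace_mul_comm, ← Matrix.mul_assoc]
    change (P * S).trace = _
    simp only [Matrix.trace, Matrix.diag_apply, Matrix.mul_apply (M := P)]
    exact Finset.sum_congr rfl fun i _ => Finset.sum_congr rfl fun j _ => by rw [hS.apply i j]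
  have h4 : ∑ i, ∑ j, P i j * S i j = (1 / 2) * (∑ i, ∑ j, P i j * covDerivForm G t x i j +
      ∑ i, ∑ j, P i j * covDerivForm G t x j i) +
      (1 / (m : ℝ)) * codiff G t x * ∑ i, ∑ j, P i j * G x i j := by
    simp only [S, hG.ahlfors_eq ht, Finset.mul_sum, ← Finset.sum_add_distrib]
    exact Finset.sum_congr rfl fun i _ => Finset.sum_congr rfl fun j _ => by ring
  rw [h3, h4, h1, h2]
  ring

lemma smoothMat_ahlfors (hG : ∀ᶠ y in 𝓝 x, IsMetricAt G y) {t : E → Fin m → ℝ}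
    (ht : ∀ᶠ y in 𝓝 x, ∀ j, ContDiffAt ℝ ∞ (fun z => t z j) y) : SmoothMat (ahlfors G t) x := by
  have hx := hG.self_of_nhds
  have htx := ht.self_of_nhds
  have hinv := hx.smooth.inv hx.det_pos.ne'
  have hΓ : ∀ k i j, ContDiffAt ℝ ∞ (fun y => christoffel G y k i j) x := fun k i j =>
    contDiffAt_const.mul (ContDiffAt.sum fun l _ => (hinv k l).mul
      (((ContDiffAt.pd i (hx.smooth j l)).add (ContDiffAt.pd j (hx.smooth i l))).sub
        (ContDiffAt.pd l (hx.smooth i j))))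
  have hD : ∀ i j, ContDiffAt ℝ ∞ (fun y => covDerivForm G t y i j) x := fun i j =>
    (ContDiffAt.pd i (htx j)).sub (ContDiffAt.sum fun k _ => (hΓ k i j).mul (htx k))
  have hδ : ContDiffAt ℝ ∞ (codiff G t) x :=
    (ContDiffAt.sum fun i _ => ContDiffAt.sum fun j _ => (hinv i j).mul (hD i j)).neg
  intro i j
  have hev : (fun y => ahlfors G t y i j) =ᶠ[𝓝 x] fun y =>
      (1 / 2) * (covDerivForm G t y i j + covDerivForm G t y j i) +
      (1 / (m : ℝ)) * codiff G t y * G y i j := by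
    filter_upwards [hG, ht] with y hy hty using hy.ahlfors_eq hty i j
  refine ContDiffAt.congr_of_eventuallyEq ?_ hev
  exact (contDiffAt_const.mul ((hD i j).add (hD j i))).add
    ((contDiffAt_const.mul hδ).mul (hx.smooth i j))

/-- If a divergence-free tensor `A` agrees with the Cauchy-Ahlfors operator of `t`, then the vector
field dual to `A(t♯, ·)` has divergence `|A|²`. Here the divergence of `X` is written as
`(det g)^(-1/2) ∂ᵢ((det g)^(1/2) Xⁱ)`. -/
theorem sum_pd_sqrt_det_mul (hG : ∀ᶠ y in 𝓝 x, IsMetricAt G y) (hm : m ≠ 0)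
    {t : E → Fin m → ℝ} (ht : ∀ᶠ y in 𝓝 x, ∀ j, ContDiffAt ℝ ∞ (fun z => t z j) y)
    {A : E → Matrix (Fin m) (Fin m) ℝ} (hA : A =ᶠ[𝓝 x] ahlfors G t)
    (hdiv : ∀ k, divTensor G A x k = 0) :
    ∑ i, pd i (fun y => √(G y).det * ((G y)⁻¹ *ᵥ (A y *ᵥ ((G y)⁻¹ *ᵥ t y))) i) x =
      √(G x).det * matInner (G x) (A x) (A x) := by
  have hx := hG.self_of_nhds
  have htx := ht.self_of_nhds
  have hinv := hx.smooth.inv hx.det_pos.ne'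
  have hAs : SmoothMat A x := fun i j =>
    (smoothMat_ahlfors hG ht i j).congr_of_eventuallyEq (hA.mono fun y hy => congrFun (congrFun hy i) j)
  set ξ : E → Fin m → ℝ := fun y => (G y)⁻¹ *ᵥ t y
  have hξ := contDiffAt_mulVec hinv htx
  have hW := contDiffAt_mulVec hAs hξ
  have hX := contDiffAt_mulVec hinv hW
  set X : E → Fin m → ℝ := fun y => (G y)⁻¹ *ᵥ (A y *ᵥ ξ y)
  -- Raising an index commutes with the covariant derivative.
  have hdξ : ∀ i, pdVec i ξ x = (G x)⁻¹ *ᵥ covDerivForm G t x i - christoffelMat G x i *ᵥ ξ x := by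
    intro i
    rw [covDerivForm_eq, Matrix.mulVec_sub]
    simp only [ξ]
    rw [pdVec_mulVec hinv.diffMat fun j => (htx j).differentiableAt (by simp), hx.pdMat_inv_eq,
      Matrix.neg_mulVec, Matrix.add_mulVec, ← Matrix.mulVec_mulVec, ← Matrix.mulVec_mulVec]
    abel
  -- `∇ᵢX` is the dual of `(∇ᵢA)(ξ, ·) + A(∇ᵢξ, ·)`.
  have hdX : ∀ i, pdVec i X x = (G x)⁻¹ *ᵥ (Matrix.of (covDerivTensor G A x i) *ᵥ ξ x) +
      ((G x)⁻¹ * A x * (G x)⁻¹) *ᵥ covDerivForm G t x i - christoffelMat G x i *ᵥ X x := by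
    intro i
    rw [covDerivTensor_eq, pdVec_mulVec hinv.diffMat fun j => (hW j).differentiableAt (by simp),
      pdVec_mulVec hAs.diffMat fun j => (hξ j).differentiableAt (by simp), hx.pdMat_inv_eq, hdξ]
    simp only [Matrix.neg_mulVec, Matrix.add_mulVec, Matrix.sub_mulVec, Matrix.mulVec_add,
      Matrix.mulVec_sub, ← Matrix.mulVec_mulVec, X]
    abel
  have hsq : DifferentiableAt ℝ (fun y => √(G y).det) x :=
    ((contDiffAt_det hx.smooth).differentiableAt (by simp)).sqrt hx.det_pos.ne'
  have hterm : ∀ i, pd i (fun y => √(G y).det * X y i) x = √(G x).det *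
      ((christoffelMat G x i).trace * X x i + pdVec i X x i) := by
    intro i
    rw [pd_mul hsq ((hX i).differentiableAt (by simp)), hx.pd_sqrt_det]
    simp only [pdVec]
    ring
  -- The Christoffel symbols of `∇X` cancel against the derivative of the volume density.
  have h1 : ∑ i, (christoffelMat G x i *ᵥ X x) i = ∑ i, (christoffelMat G x i).trace * X x i := by
    simp only [Matrix.mulVec, dotProduct, Matrix.trace, Matrix.diag_apply, Finset.sum_mul]
    rw [Finset.sum_comm]
    refine Finset.sum_congr rfl fun i _ => Finset.sum_congr rfl fun j _ => ?_
    simp only [christoffelMat, Matrix.of_apply]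
    rw [hx.christoffel_symm]
  have h2 : ∑ i, ((G x)⁻¹ *ᵥ (Matrix.of (covDerivTensor G A x i) *ᵥ ξ x)) i = 0 := by
    calc _ = ∑ k, divTensor G A x k * ξ x k := by
          simp only [Matrix.mulVec, dotProduct, Matrix.of_apply, divTensor, Finset.sum_mul,
            Finset.mul_sum]
          rw [Finset.sum_comm' (t' := Finset.univ) (s' := fun _ => Finset.univ) (by simp)]
          calc _ = ∑ j, ∑ k, ∑ i, (G x)⁻¹ i j * covDerivTensor G A x i j k * ξ x k := by
                refine Finset.sum_congr rfl fun j _ => ?_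
                rw [Finset.sum_comm]
                exact Finset.sum_congr rfl fun k _ => Finset.sum_congr rfl fun i _ => by ring
            _ = _ := by
                rw [Finset.sum_comm]
                exact Finset.sum_congr rfl fun k _ => Finset.sum_comm
      _ = 0 := by simp [hdiv]
  have h3 : ∑ i, (((G x)⁻¹ * A x * (G x)⁻¹) *ᵥ covDerivForm G t x i) i =
      matInner (G x) (A x) (A x) := by
    rw [hA.self_of_nhds, ← hx.sum_mul_covDerivForm hm htx]
    rfl
  calc _ = √(G x).det * ∑ i, ((christoffelMat G x i).trace * X x i + pdVec i X x i) := by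
        rw [Finset.mul_sum]
        exact Finset.sum_congr rfl fun i _ => hterm i
    _ = _ := by
        simp only [hdX, Pi.sub_apply, Pi.add_apply, Finset.sum_add_distrib,
          Finset.sum_sub_distrib, h1, h2, h3]
        ring

end IsMetricAt

/-- `div (u g) = du`. -/
lemma divTensor_smul_metric (hG : IsMetricAt G x) {u : E → ℝ} (hu : DifferentiableAt ℝ u x)
    (k : Fin m) : divTensor G (fun y => u y • G y) x k = pd k u x := by
  have hcov : ∀ i, Matrix.of (covDerivTensor G (fun y => u y • G y) x i) = pd i u x • G x := by
    intro i
    have hpd : pdMat i (fun y => u y • G y) x = pd i u x • G x + u x • pdMat i G x := by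
      ext j k
      simp only [pdMat, Matrix.of_apply, Matrix.add_apply, Matrix.smul_apply, smul_eq_mul]
      exact pd_mul hu (hG.smooth.diffMat j k)
    rw [IsMetricAt.covDerivTensor_eq, hpd, hG.pdMat_eq, smul_add, Matrix.mul_smul, Matrix.smul_mul]
    abel
  have hcov' : ∀ i j k, covDerivTensor G (fun y => u y • G y) x i j k = pd i u x * G x j k :=
    fun i j k => congrFun (congrFun (hcov i) j) k
  calc _ = ∑ i, pd i u x * ((G x)⁻¹ * G x) i k := by
        simp only [divTensor, hcov', Matrix.mul_apply, Finset.mul_sum]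
        exact Finset.sum_congr rfl fun i _ => Finset.sum_congr rfl fun j _ => by ring
    _ = _ := by
        rw [Matrix.nonsing_inv_mul _ hG.isUnit_det]
        simp [Matrix.one_apply]

lemma divTensor_add {A B : E → Matrix (Fin m) (Fin m) ℝ} (hA : DiffMat A x) (hB : DiffMat B x)
    (k : Fin m) :
    divTensor G (fun y => A y + B y) x k = divTensor G A x k + divTensor G B x k := by
  simp only [divTensor, ← Finset.sum_add_distrib]
  refine Finset.sum_congr rfl fun i _ => Finset.sum_congr rfl fun j _ => ?_
  have h : covDerivTensor G (fun y => A y + B y) x i j k =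
      covDerivTensor G A x i j k + covDerivTensor G B x i j k := by
    simp only [covDerivTensor, Matrix.add_apply]
    rw [pd_add (hA j k) (hB j k)]
    simp only [mul_add, Finset.sum_add_distrib]
    ring
  rw [h]
  ring

end Coordinates

/-! ### Components in charts: smoothness and change of charts -/

section Charts

open IsManifold

variable {m : ℕ} {M : Type*} [TopologicalSpace M]

/-- The Jacobian matrix of the transition map from the chart `e'` to the chart `e`. -/
noncomputable def jacobian (e e' : OpenPartialHomeomorph M (EuclideanSpace ℝ (Fin m)))
    (x : EuclideanSpace ℝ (Fin m)) : Matrix (Fin m) (Fin m) ℝ :=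
  LinearMap.toMatrix (EuclideanSpace.basisFun (Fin m) ℝ).toBasis
    (EuclideanSpace.basisFun (Fin m) ℝ).toBasis (fderiv ℝ (e ∘ e'.symm) x).toLinearMap

lemma det_jacobian (e e' : OpenPartialHomeomorph M (EuclideanSpace ℝ (Fin m)))
    (x : EuclideanSpace ℝ (Fin m)) : (jacobian e e' x).det = (fderiv ℝ (e ∘ e'.symm) x).det :=
  LinearMap.det_toMatrix _ _

variable [ChartedSpace (EuclideanSpace ℝ (Fin m)) M]
  {e e' : OpenPartialHomeomorph M (EuclideanSpace ℝ (Fin m))} {x : EuclideanSpace ℝ (Fin m)}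

lemma mdifferentiableAt_symm_of_mem {e : OpenPartialHomeomorph M (EuclideanSpace ℝ (Fin m))}
    (he : e ∈ maximalAtlas (𝓡 m) ∞ M) {x : EuclideanSpace ℝ (Fin m)} (hx : x ∈ e.target) :
    MDifferentiableAt (𝓡 m) (𝓡 m) e.symm x :=
  (contMDiffAt_symm_of_mem_maximalAtlas he hx).mdifferentiableAt (by simp)

lemma contDiffAt_transition (he : e ∈ maximalAtlas (𝓡 m) ∞ M)
    (he' : e' ∈ maximalAtlas (𝓡 m) ∞ M) (hx : x ∈ e'.target) (hx' : e'.symm x ∈ e.source) :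
    ContDiffAt ℝ ∞ (e ∘ e'.symm) x :=
  ((contMDiffAt_of_mem_maximalAtlas he hx').comp x
    (contMDiffAt_symm_of_mem_maximalAtlas he' hx)).contDiffAt

lemma isUnit_det_jacobian (he : e ∈ maximalAtlas (𝓡 m) ∞ M)
    (he' : e' ∈ maximalAtlas (𝓡 m) ∞ M) (hx : x ∈ e'.target) (hx' : e'.symm x ∈ e.source) :
    IsUnit (jacobian e e' x).det := by
  have h1 := (contDiffAt_transition he he' hx hx').differentiableAt (by simp)
  have hy : e (e'.symm x) ∈ e.target := e.map_source hx'
  have hy' : e.symm (e (e'.symm x)) ∈ e'.source := by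
    rw [e.left_inv hx']; exact e'.map_target hx
  have h2 := (contDiffAt_transition he' he hy hy').differentiableAt (by simp)
  have hcomp : (e' ∘ e.symm) ∘ (e ∘ e'.symm) =ᶠ[𝓝 x] id := by
    filter_upwards [e'.open_target.mem_nhds hx,
      (e'.continuousAt_symm hx).preimage_mem_nhds (e.open_source.mem_nhds hx')] with z hz hz'
    simp [e.left_inv hz', e'.right_inv hz]
  have h3 : (fderiv ℝ (e' ∘ e.symm) (e (e'.symm x)) : EuclideanSpace ℝ (Fin m) →L[ℝ] _) ∘L
      (fderiv ℝ (e ∘ e'.symm) x : EuclideanSpace ℝ (Fin m) →L[ℝ] _) =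
      ContinuousLinearMap.id ℝ (EuclideanSpace ℝ (Fin m)) := by
    have := hcomp.fderiv_eq (𝕜 := ℝ)
    rwa [fderiv_id, fderiv_comp x h2 h1] at this
  rw [det_jacobian]
  have h4 := congrArg ContinuousLinearMap.det h3
  simp only [ContinuousLinearMap.det, ContinuousLinearMap.toLinearMap_comp, LinearMap.det_comp,
    ContinuousLinearMap.coe_id, LinearMap.det_id] at h4
  exact IsUnit.of_mul_eq_one_right _ h4

/-- Coordinate vectors transform with the Jacobian matrix. All tangent spaces are the same type
by definition, so the two sides can be compared although their base points agree only
propositionally. -/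
lemma coordVec_transition (he : e ∈ maximalAtlas (𝓡 m) ∞ M)
    (he' : e' ∈ maximalAtlas (𝓡 m) ∞ M) (hx : x ∈ e'.target) (hx' : e'.symm x ∈ e.source)
    (j : Fin m) :
    (coordVec e' x j : EuclideanSpace ℝ (Fin m)) =
      ∑ i, jacobian e e' x i j • (coordVec e (e (e'.symm x)) i : EuclideanSpace ℝ (Fin m)) := by
  have h1 := (contDiffAt_transition he he' hx hx').differentiableAt (by simp)
  have hy : e (e'.symm x) ∈ e.target := e.map_source hx'
  have hev : e'.symm =ᶠ[𝓝 x] e.symm ∘ (e ∘ e'.symm) := by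
    filter_upwards [(e'.continuousAt_symm hx).preimage_mem_nhds (e.open_source.mem_nhds hx')]
      with z hz
    simp [e.left_inv hz]
  have h2 : ∀ v : EuclideanSpace ℝ (Fin m),
      (mfderiv (𝓡 m) (𝓡 m) e'.symm x v : EuclideanSpace ℝ (Fin m)) =
      (mfderiv (𝓡 m) (𝓡 m) e.symm (e (e'.symm x)) (fderiv ℝ (e ∘ e'.symm) x v) :
        EuclideanSpace ℝ (Fin m)) := by
    intro v
    have h3 := (mdifferentiableAt_symm_of_mem he hy).hasMFDerivAt.comp x
      h1.mdifferentiableAt.hasMFDerivAt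
    have h4 := (h3.congr_of_eventuallyEq hev).mfderiv
    rw [h4, mfderiv_eq_fderiv]
    rfl
  have h5 : (fderiv ℝ (e ∘ e'.symm) x (EuclideanSpace.single j 1) : EuclideanSpace ℝ (Fin m)) =
      ∑ i, jacobian e e' x i j • (EuclideanSpace.single i (1 : ℝ)) := by
    ext k
    simp [jacobian, LinearMap.toMatrix_apply, Pi.single_apply]
  refine (h2 _).trans ?_
  rw [h5]
  exact (map_sum (mfderiv (𝓡 m) (𝓡 m) e.symm (e (e'.symm x))) _ _).trans
    (Finset.sum_congr rfl fun i _ => map_smul (mfderiv (𝓡 m) (𝓡 m) e.symm (e (e'.symm x))) _ _)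

/-- The derivative of a function on `M` in terms of its expression in a chart. -/
lemma mvfderiv_mfderiv_symm (he : e ∈ maximalAtlas (𝓡 m) ∞ M) (hx : x ∈ e.target) {ρ : M → ℝ}
    (hρ : MDifferentiableAt (𝓡 m) 𝓘(ℝ) ρ (e.symm x)) (a : EuclideanSpace ℝ (Fin m)) :
    mvfderiv (𝓡 m) ρ (e.symm x) (mfderiv (𝓡 m) (𝓡 m) e.symm x a) =
      fderiv ℝ (ρ ∘ e.symm) x a := by
  have h := mfderiv_comp x hρ (mdifferentiableAt_symm_of_mem he hx)
  rw [← mfderiv_eq_fderiv, h]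
  rfl

/-- Components of a two-tensor transform by congruence with the Jacobian matrix. -/
lemma tensorComp_transition (he : e ∈ maximalAtlas (𝓡 m) ∞ M)
    (he' : e' ∈ maximalAtlas (𝓡 m) ∞ M) (hx : x ∈ e'.target) (hx' : e'.symm x ∈ e.source)
    (T : Tensor2 m M) :
    tensorComp e' T x =
      (jacobian e e' x)ᵀ * tensorComp e T (e (e'.symm x)) * jacobian e e' x := by
  ext i j
  have hbase : ∀ (p q : M), p = q → ∀ a b : EuclideanSpace ℝ (Fin m),
      (T p : EuclideanSpace ℝ (Fin m) →L[ℝ] EuclideanSpace ℝ (Fin m) →L[ℝ] ℝ) a b =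
      (T q : EuclideanSpace ℝ (Fin m) →L[ℝ] EuclideanSpace ℝ (Fin m) →L[ℝ] ℝ) a b := by
    rintro p q rfl a b
    rfl
  have h1 : tensorComp e' T x i j = (T (e'.symm x) : EuclideanSpace ℝ (Fin m) →L[ℝ]
      EuclideanSpace ℝ (Fin m) →L[ℝ] ℝ) (coordVec e' x i : EuclideanSpace ℝ (Fin m))
      (coordVec e' x j : EuclideanSpace ℝ (Fin m)) := rfl
  rw [h1, coordVec_transition he he' hx hx', coordVec_transition he he' hx hx']
  refine (hbase _ _ (e.left_inv hx').symm _ _).trans ?_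
  simp only [map_sum, map_smul, _root_.sum_apply, _root_.smul_apply,
    Matrix.mul_apply, Matrix.transpose_apply, smul_eq_mul, Finset.mul_sum, Finset.sum_mul]
  refine Finset.sum_congr rfl fun a _ => Finset.sum_congr rfl fun b _ => ?_
  simp only [tensorComp, Matrix.of_apply]
  ring

/-- The pointwise inner product `g(A, B)` of two covariant two-tensors. -/
noncomputable def tensorInner (g A B : Tensor2 m M) (p : M) : ℝ :=
  let e := chartAt (EuclideanSpace ℝ (Fin m)) p
  matInner (tensorComp e g (e p)) (tensorComp e A (e p)) (tensorComp e B (e p))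

/-- The Riemannian volume density transforms with the absolute value of the Jacobian
determinant. -/
lemma sqrt_det_transition (he : e ∈ maximalAtlas (𝓡 m) ∞ M)
    (he' : e' ∈ maximalAtlas (𝓡 m) ∞ M) (hx : x ∈ e'.target) (hx' : e'.symm x ∈ e.source)
    (g : Tensor2 m M) : √(tensorComp e' g x).det =
      |(fderiv ℝ (e ∘ e'.symm) x).det| * √(tensorComp e g (e (e'.symm x))).det := by
  rw [tensorComp_transition he he' hx hx', Matrix.det_mul, Matrix.det_mul, Matrix.det_transpose,
    ← det_jacobian, mul_right_comm, ← sq, Real.sqrt_mul (sq_nonneg _), Real.sqrt_sq_eq_abs]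

/-- The coordinate vectors are a basis of the tangent space. -/
lemma mfderiv_symm_bijective (he : e ∈ maximalAtlas (𝓡 m) ∞ M) (hx : x ∈ e.target) :
    Function.Bijective (mfderiv (𝓡 m) (𝓡 m) e.symm x) := by
  have hM : e.MDifferentiable (𝓡 m) (𝓡 m) :=
    ⟨(contMDiffOn_of_mem_maximalAtlas he).mdifferentiableOn (by simp),
      (contMDiffOn_symm_of_mem_maximalAtlas he).mdifferentiableOn (by simp)⟩
  exact hM.symm.mfderiv_bijective hx

lemma tensor_apply_mfderiv_symm (T : Tensor2 m M) (a b : EuclideanSpace ℝ (Fin m)) :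
    T (e.symm x) (mfderiv (𝓡 m) (𝓡 m) e.symm x a) (mfderiv (𝓡 m) (𝓡 m) e.symm x b) =
      ∑ i, ∑ j, a i * b j * tensorComp e T x i j := by
  have hsum : ∀ a : EuclideanSpace ℝ (Fin m), mfderiv (𝓡 m) (𝓡 m) e.symm x a =
      ∑ i, a i • coordVec e x i := by
    intro a
    have h1 : a = ∑ i, a i • (EuclideanSpace.single i (1 : ℝ) : EuclideanSpace ℝ (Fin m)) := by
      ext k
      simp [Pi.single_apply]
    calc mfderiv (𝓡 m) (𝓡 m) e.symm x a = mfderiv (𝓡 m) (𝓡 m) e.symm x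
          (∑ i, a i • (EuclideanSpace.single i (1 : ℝ) : EuclideanSpace ℝ (Fin m))) :=
        congrArg (mfderiv (𝓡 m) (𝓡 m) e.symm x) h1
      _ = _ := (map_sum (mfderiv (𝓡 m) (𝓡 m) e.symm x) _ _).trans
        (Finset.sum_congr rfl fun i _ => map_smul (mfderiv (𝓡 m) (𝓡 m) e.symm x) _ _)
  rw [hsum, hsum]
  simp only [map_sum, map_smul, _root_.sum_apply, _root_.smul_apply,
    smul_eq_mul, Finset.mul_sum]
  rw [Finset.sum_comm]
  refine Finset.sum_congr rfl fun i _ => Finset.sum_congr rfl fun j _ => ?_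
  simp only [tensorComp, Matrix.of_apply]
  ring

/-- A two-tensor is determined by its components in a chart. -/
lemma tensor_ext_of_tensorComp (he : e ∈ maximalAtlas (𝓡 m) ∞ M) (hx : x ∈ e.target)
    {T T' : Tensor2 m M} (h : tensorComp e T x = tensorComp e T' x) :
    T (e.symm x) = T' (e.symm x) := by
  ext v w
  obtain ⟨a, rfl⟩ := (mfderiv_symm_bijective he hx).2 v
  obtain ⟨b, rfl⟩ := (mfderiv_symm_bijective he hx).2 w
  refine (tensor_apply_mfderiv_symm T a b).trans (Eq.trans ?_ (tensor_apply_mfderiv_symm T' a b).symm)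
  rw [h]

lemma posDef_tensorComp (he : e ∈ maximalAtlas (𝓡 m) ∞ M) (hx : x ∈ e.target) {g : Tensor2 m M}
    (hsymm : ∀ p v w, g p v w = g p w v) (hpos : ∀ p v, v ≠ 0 → 0 < g p v v) :
    (tensorComp e g x).PosDef := by
  refine Matrix.PosDef.of_dotProduct_mulVec_pos ?_ fun a ha => ?_
  · rw [Matrix.IsHermitian, Matrix.conjTranspose_eq_transpose_of_trivial]
    ext i j
    exact hsymm _ _ _
  · have h0 : mfderiv (𝓡 m) (𝓡 m) e.symm x (WithLp.toLp 2 a) ≠ 0 := fun h => ha <| by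
      have := (mfderiv_symm_bijective he hx).1 (h.trans (map_zero _).symm)
      exact congrArg WithLp.ofLp this
    refine (hpos _ _ h0).trans_eq ((tensor_apply_mfderiv_symm g _ _).trans ?_)
    simp only [dotProduct, Matrix.mulVec, Finset.mul_sum, star_trivial]
    exact Finset.sum_congr rfl fun i _ => Finset.sum_congr rfl fun j _ => by
      change a i * a j * _ = _
      ring

variable [IsManifold (𝓡 m) ∞ M]

/-- The coordinate vector fields are smooth. -/
lemma contMDiffAt_coordVec {e : OpenPartialHomeomorph M (EuclideanSpace ℝ (Fin m))}
    (he : e ∈ maximalAtlas (𝓡 m) ∞ M) {x : EuclideanSpace ℝ (Fin m)} (hx : x ∈ e.target)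
    (i : Fin m) :
    ContMDiffAt (𝓡 m) (𝓡 m).tangent ∞
      (fun y => (⟨e.symm y, coordVec e y i⟩ : TangentBundle (𝓡 m) M)) x := by
  have : IsManifold (𝓡 m) 1 M := IsManifold.of_le (n := ∞) (by simp)
  have h1 := (contMDiffOn_symm_of_mem_maximalAtlas he).contMDiffOn_tangentMapWithin
    (m := ∞) (by simp) e.open_target.uniqueMDiffOn
  have h2 : ContMDiff (𝓡 m) (𝓡 m).tangent ∞ (fun y : EuclideanSpace ℝ (Fin m) =>
      (⟨y, EuclideanSpace.single i (1 : ℝ)⟩ : TangentBundle (𝓡 m) (EuclideanSpace ℝ (Fin m)))) := by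
    exact contMDiff_vectorSpace_iff_contDiff.2 contDiff_const
  have h3 := h1.comp (h2.contMDiffOn (s := e.target)) (fun y hy => hy)
  refine ContMDiffAt.congr_of_eventuallyEq (h3.contMDiffAt (e.open_target.mem_nhds hx)) ?_
  filter_upwards [e.open_target.mem_nhds hx] with y hy
  have h4 := tangentMapWithin_eq_tangentMap
    (p := (⟨y, EuclideanSpace.single i (1 : ℝ)⟩ : TangentBundle (𝓡 m) (EuclideanSpace ℝ (Fin m))))
    (e.open_target.uniqueMDiffOn y hy) (mdifferentiableAt_symm_of_mem he hy)
  exact h4.symm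

/-- Evaluating a smooth two-tensor on smooth vector fields along a map gives a smooth function. -/
lemma contMDiffAt_tensor_apply {M' : Type*} [TopologicalSpace M'] {n : ℕ}
    [ChartedSpace (EuclideanSpace ℝ (Fin n)) M'] {T : Tensor2 m M} (hT : SmoothTensor2 T)
    {b : M' → M} {v w : ∀ q, TangentSpace (𝓡 m) (b q)} {q : M'}
    (hv : ContMDiffAt (𝓡 n) (𝓡 m).tangent ∞ (fun q => (⟨b q, v q⟩ : TangentBundle (𝓡 m) M)) q)
    (hw : ContMDiffAt (𝓡 n) (𝓡 m).tangent ∞ (fun q => (⟨b q, w q⟩ : TangentBundle (𝓡 m) M)) q) :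
    ContMDiffAt (𝓡 n) 𝓘(ℝ) ∞ (fun q => T (b q) (v q) (w q)) q := by
  have hb : ContMDiffAt (𝓡 n) (𝓡 m) ∞ b q := (Bundle.contMDiffAt_totalSpace.1 hv).1
  have h : ContMDiffAt (𝓡 n) ((𝓡 m).prod 𝓘(ℝ)) ∞ (fun q => Bundle.TotalSpace.mk' ℝ
      (E := Bundle.Trivial M ℝ) (b q) (T (b q) (v q) (w q))) q := by
    apply ContMDiffAt.clm_bundle_apply₂ (F₁ := EuclideanSpace ℝ (Fin m))
      (F₂ := EuclideanSpace ℝ (Fin m))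
    · exact ContMDiffAt.comp q hT.contMDiffAt hb
    · exact hv
    · exact hw
  exact (Bundle.contMDiffAt_totalSpace.1 h).2

lemma smoothMat_tensorComp {T : Tensor2 m M} (hT : SmoothTensor2 T)
    {e : OpenPartialHomeomorph M (EuclideanSpace ℝ (Fin m))}
    (he : e ∈ maximalAtlas (𝓡 m) ∞ M) {x : EuclideanSpace ℝ (Fin m)} (hx : x ∈ e.target) :
    SmoothMat (tensorComp e T) x := fun i j =>
  (contMDiffAt_tensor_apply hT (contMDiffAt_coordVec he hx i)
    (contMDiffAt_coordVec he hx j)).contDiffAt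

lemma contDiffAt_formComp {θ : Form m M} (hθ : SmoothForm θ)
    {e : OpenPartialHomeomorph M (EuclideanSpace ℝ (Fin m))}
    (he : e ∈ maximalAtlas (𝓡 m) ∞ M) {x : EuclideanSpace ℝ (Fin m)} (hx : x ∈ e.target)
    (i : Fin m) : ContDiffAt ℝ ∞ (fun y => formComp e θ y i) x := by
  have hv := contMDiffAt_coordVec he hx i
  have h : ContMDiffAt (𝓡 m) ((𝓡 m).prod 𝓘(ℝ)) ∞ (fun y => Bundle.TotalSpace.mk' ℝ
      (E := Bundle.Trivial M ℝ) (e.symm y) (θ (e.symm y) (coordVec e y i))) x := by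
    apply ContMDiffAt.clm_bundle_apply (F₁ := EuclideanSpace ℝ (Fin m))
    · exact ContMDiffAt.comp x hθ.contMDiffAt (Bundle.contMDiffAt_totalSpace.1 hv).1
    · exact hv
  exact (Bundle.contMDiffAt_totalSpace.1 h).2.contDiffAt

/-- The trace can be computed in any chart. -/
lemma traceTensor_eq (he : e ∈ maximalAtlas (𝓡 m) ∞ M) (hx : x ∈ e.target) (g T : Tensor2 m M) :
    traceTensor g T (e.symm x) = matTrace (tensorComp e g x) (tensorComp e T x) := by
  have he' := chart_mem_maximalAtlas (I := 𝓡 m) (n := ∞) (e.symm x)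
  have hs := mem_chart_source (EuclideanSpace ℝ (Fin m)) (e.symm x)
  rw [tensorComp_transition he' he hx hs, tensorComp_transition he' he hx hs,
    matTrace_congr _ _ _ (isUnit_det_jacobian he' he hx hs)]
  rfl

/-- The inner product of two-tensors can be computed in any chart. -/
lemma tensorInner_eq (he : e ∈ maximalAtlas (𝓡 m) ∞ M) (hx : x ∈ e.target)
    (g A B : Tensor2 m M) : tensorInner g A B (e.symm x) =
      matInner (tensorComp e g x) (tensorComp e A x) (tensorComp e B x) := by
  have he' := chart_mem_maximalAtlas (I := 𝓡 m) (n := ∞) (e.symm x)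
  have hs := mem_chart_source (EuclideanSpace ℝ (Fin m)) (e.symm x)
  rw [tensorComp_transition he' he hx hs, tensorComp_transition he' he hx hs,
    tensorComp_transition he' he hx hs, matInner_congr _ _ _ _ (isUnit_det_jacobian he' he hx hs)]
  rfl

end Charts

/-! ### Integration by parts in a chart -/

section EuclideanIntegration

open MeasureTheory

variable {F : Type*} [NormedAddCommGroup F] {U K : Set F} {h : F → ℝ}

lemma indicator_eventuallyEq_of_mem (hU : IsOpen U) {x : F} (hx : x ∈ U) :
    U.indicator h =ᶠ[𝓝 x] h := by
  filter_upwards [hU.mem_nhds hx] with y hy using Set.indicator_of_mem hy h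

lemma indicator_eventuallyEq_zero (hK : IsClosed K) (h0 : ∀ x ∈ U, x ∉ K → h x = 0) {x : F}
    (hx : x ∉ K) : U.indicator h =ᶠ[𝓝 x] fun _ => 0 := by
  filter_upwards [hK.isOpen_compl.mem_nhds hx] with y hy
  by_cases hyU : y ∈ U
  · rw [Set.indicator_of_mem hyU, h0 y hyU hy]
  · rw [Set.indicator_of_notMem hyU]

lemma continuous_indicator_of_subset (hU : IsOpen U) (hK : IsCompact K) (hKU : K ⊆ U)
    (h0 : ∀ x ∈ U, x ∉ K → h x = 0) (hh : ContinuousOn h U) : Continuous (U.indicator h) := by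
  refine continuous_iff_continuousAt.2 fun x => ?_
  by_cases hx : x ∈ U
  · exact (hh.continuousAt (hU.mem_nhds hx)).congr (indicator_eventuallyEq_of_mem hU hx).symm
  · exact continuousAt_const.congr
      (indicator_eventuallyEq_zero hK.isClosed h0 fun hxK => hx (hKU hxK)).symm

lemma contDiff_indicator_of_subset [NormedSpace ℝ F] {n : WithTop ℕ∞} (hU : IsOpen U)
    (hK : IsCompact K) (hKU : K ⊆ U) (h0 : ∀ x ∈ U, x ∉ K → h x = 0)
    (hh : ∀ x ∈ U, ContDiffAt ℝ n h x) :
    ContDiff ℝ n (U.indicator h) := by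
  refine contDiff_iff_contDiffAt.2 fun x => ?_
  by_cases hx : x ∈ U
  · exact (hh x hx).congr_of_eventuallyEq (indicator_eventuallyEq_of_mem hU hx)
  · exact contDiffAt_const.congr_of_eventuallyEq
      (indicator_eventuallyEq_zero hK.isClosed h0 fun hxK => hx (hKU hxK))

lemma hasCompactSupport_indicator (hK : IsCompact K) (h0 : ∀ x ∈ U, x ∉ K → h x = 0) :
    HasCompactSupport (U.indicator h) :=
  HasCompactSupport.intro hK fun _ hx =>
    (indicator_eventuallyEq_zero hK.isClosed h0 hx).self_of_nhds

variable [MeasurableSpace F] [BorelSpace F] {μ : Measure F}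

lemma integrableOn_of_vanishing [IsFiniteMeasureOnCompacts μ] (hU : IsOpen U) (hK : IsCompact K)
    (hKU : K ⊆ U) (h0 : ∀ x ∈ U, x ∉ K → h x = 0) (hh : ContinuousOn h U) :
    IntegrableOn h U μ :=
  (integrable_indicator_iff hU.measurableSet).1 <|
    (continuous_indicator_of_subset hU hK hKU h0 hh).integrable_of_hasCompactSupport
      (hasCompactSupport_indicator hK h0)

/-- A nonnegative continuous function with vanishing integral vanishes. -/
lemma eq_zero_of_setIntegral_eq_zero [IsFiniteMeasureOnCompacts μ] [μ.IsOpenPosMeasure]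
    (hU : IsOpen U) (hK : IsCompact K) (hKU : K ⊆ U) (h0 : ∀ x ∈ U, x ∉ K → h x = 0)
    (hh : ContinuousOn h U) (hpos : ∀ x ∈ U, 0 ≤ h x) (hint : ∫ x in U, h x ∂μ = 0) :
    ∀ x ∈ U, h x = 0 := by
  intro x hx
  by_contra hne
  have h1 := (continuous_indicator_of_subset hU hK hKU h0 hh)
    |>.integral_pos_of_hasCompactSupport_nonneg_nonzero (μ := μ) (x := x)
      (hasCompactSupport_indicator hK h0) (fun y => Set.indicator_nonneg hpos y)
      (by rwa [Set.indicator_of_mem hx])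
  rw [integral_indicator hU.measurableSet, hint] at h1
  exact lt_irrefl _ h1

lemma integral_fderiv_apply_eq_zero [NormedSpace ℝ F] [FiniteDimensional ℝ F]
    [μ.IsAddHaarMeasure] {u : F → ℝ} (hu : ContDiff ℝ 1 u)
    (hc : HasCompactSupport u) (v : F) : ∫ x, fderiv ℝ u x v ∂μ = 0 := by
  have hi : Integrable (fun x => fderiv ℝ u x v) μ :=
    ((hu.continuous_fderiv one_ne_zero).clm_apply continuous_const).integrable_of_hasCompactSupport
      (hc.fderiv_apply (𝕜 := ℝ) v)
  have h := integral_mul_fderiv_eq_neg_fderiv_mul_of_integrable (μ := μ) (f := u)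
    (g := fun _ => (1 : ℝ)) (v := v) (by simpa using hi) (by simp)
    (by simpa using hu.continuous.integrable_of_hasCompactSupport hc)
    (fun x _ => hu.differentiable one_ne_zero x) (by fun_prop)
  simpa using h.symm

/-- Integration by parts on an open set, against a function supported in a compact subset. -/
lemma setIntegral_sum_pd_mul {m : ℕ} {U K : Set (EuclideanSpace ℝ (Fin m))} (hU : IsOpen U)
    (hK : IsCompact K) (hKU : K ⊆ U) {r : EuclideanSpace ℝ (Fin m) → ℝ}
    {Z : Fin m → EuclideanSpace ℝ (Fin m) → ℝ} (hr : ∀ x ∈ U, ContDiffAt ℝ ∞ r x)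
    (h0 : ∀ x ∈ U, x ∉ K → r x = 0) (hZ : ∀ i, ∀ x ∈ U, ContDiffAt ℝ ∞ (Z i) x) :
    ∫ x in U, r x * ∑ i, pd i (Z i) x = -∫ x in U, ∑ i, pd i r x * Z i x := by
  have h0' : ∀ i, ∀ x ∈ U, x ∉ K → pd i r x = 0 := fun i x hx hxK => by
    refine (pd_congr (v := fun _ => 0) ?_).trans (pd_const i 0 x)
    filter_upwards [hU.mem_nhds hx, hK.isClosed.isOpen_compl.mem_nhds hxK] with y hy hyK
      using h0 y hy hyK
  have hcr : ContinuousOn r U := fun x hx => (hr x hx).continuousAt.continuousWithinAt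
  have hcZ : ∀ i, ContinuousOn (Z i) U := fun i x hx => (hZ i x hx).continuousAt.continuousWithinAt
  have hcdr : ∀ i, ContinuousOn (fun x => pd i r x) U := fun i x hx =>
    ((hr x hx).pd i).continuousAt.continuousWithinAt
  have hcdZ : ∀ i, ContinuousOn (fun x => pd i (Z i) x) U := fun i x hx =>
    ((hZ i x hx).pd i).continuousAt.continuousWithinAt
  have hint1 : ∀ i, IntegrableOn (fun x => r x * pd i (Z i) x) U := fun i =>
    integrableOn_of_vanishing hU hK hKU (fun x hx hxK => by rw [h0 x hx hxK, zero_mul])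
      (hcr.mul (hcdZ i))
  have hint2 : ∀ i, IntegrableOn (fun x => pd i r x * Z i x) U := fun i =>
    integrableOn_of_vanishing hU hK hKU (fun x hx hxK => by rw [h0' i x hx hxK, zero_mul])
      ((hcdr i).mul (hcZ i))
  have hi : ∀ i, ∫ x in U, r x * pd i (Z i) x = -∫ x in U, pd i r x * Z i x := by
    intro i
    have hv : ∀ x ∈ U, x ∉ K → r x * Z i x = 0 := fun x hx hxK => by rw [h0 x hx hxK, zero_mul]
    -- The product of `r` and `Z i`, extended by zero, is a compactly supported function on `ℝᵐ`.
    have hz := integral_fderiv_apply_eq_zero (μ := volume)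
      (contDiff_indicator_of_subset (n := 1) hU hK hKU hv
        fun x hx => ((hr x hx).mul (hZ i x hx)).of_le (by simp))
      (hasCompactSupport_indicator hK hv) (EuclideanSpace.single i (1 : ℝ))
    have hd : (fun x => fderiv ℝ (U.indicator fun x => r x * Z i x) x
        (EuclideanSpace.single i (1 : ℝ))) =
        U.indicator fun x => pd i r x * Z i x + r x * pd i (Z i) x := by
      ext x
      by_cases hx : x ∈ U
      · rw [(indicator_eventuallyEq_of_mem hU hx).fderiv_eq, Set.indicator_of_mem hx]
        exact pd_mul ((hr x hx).differentiableAt (by simp)) ((hZ i x hx).differentiableAt (by simp))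
      · rw [(indicator_eventuallyEq_zero hK.isClosed hv fun hxK => hx (hKU hxK)).fderiv_eq,
          Set.indicator_of_notMem hx]
        simp
    rw [hd, integral_indicator hU.measurableSet, integral_add (hint2 i) (hint1 i)] at hz
    linarith
  simp only [Finset.mul_sum]
  rw [integral_finsetSum _ fun i _ => hint1 i, integral_finsetSum _ fun i _ => hint2 i,
    ← Finset.sum_neg_distrib]
  exact Finset.sum_congr rfl fun i _ => hi i

end EuclideanIntegration

/-! ### The divergence theorem on a compact manifold -/

section Divergence

open MeasureTheory IsManifold

variable {m : ℕ} {M : Type*} [TopologicalSpace M]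
  {e e' : OpenPartialHomeomorph M (EuclideanSpace ℝ (Fin m))} {x : EuclideanSpace ℝ (Fin m)}

/-- Functions supported in a compact subset of a chart vanish off a compact subset of its target. -/
lemma vanishing_comp_symm {K : Set M} {u : M → ℝ} (hu : ∀ p, p ∉ K → u p = 0) :
    ∀ x ∈ e.target, x ∉ e '' K → u (e.symm x) = 0 := fun x hx hxK =>
  hu _ fun hp => hxK ⟨e.symm x, hp, e.right_inv hx⟩

lemma isCompact_image_chart {K : Set M} (hK : IsCompact K) (hKe : K ⊆ e.source) :
    IsCompact (e '' K) ∧ e '' K ⊆ e.target := by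
  refine ⟨hK.image_of_continuousOn (e.continuousOn.mono hKe), ?_⟩
  rintro _ ⟨p, hp, rfl⟩
  exact e.map_source (hKe hp)

variable [ChartedSpace (EuclideanSpace ℝ (Fin m)) M]

/-- A Riemannian metric, its smoothness being expressed by the components in charts. -/
structure IsRiemannian (g : Tensor2 m M) : Prop where
  smooth : ∀ e ∈ maximalAtlas (𝓡 m) ∞ M, ∀ x ∈ e.target, SmoothMat (tensorComp e g) x
  symm : ∀ p v w, g p v w = g p w v
  pos : ∀ p v, v ≠ 0 → 0 < g p v v

lemma IsRiemannian.isMetricAt {g : Tensor2 m M} (hg : IsRiemannian g)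
    {e : OpenPartialHomeomorph M (EuclideanSpace ℝ (Fin m))}
    (he : e ∈ maximalAtlas (𝓡 m) ∞ M) {x : EuclideanSpace ℝ (Fin m)} (hx : x ∈ e.target) :
    IsMetricAt (tensorComp e g) x where
  smooth := hg.smooth e he x hx
  symm := Eventually.of_forall fun _ => Matrix.IsSymm.ext fun _ _ => hg.symm _ _ _
  det_pos := (posDef_tensorComp he hx hg.symm hg.pos).det_pos

/-- The integral of a function on `M` over the domain of the chart `e`, with respect to the
Riemannian volume element. -/
noncomputable def chartIntegral (g : Tensor2 m M)
    (e : OpenPartialHomeomorph M (EuclideanSpace ℝ (Fin m))) (u : M → ℝ) : ℝ :=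
  ∫ x in e.target, u (e.symm x) * √(tensorComp e g x).det

/-- The two-tensor `dρ ⊗ θ`. -/
noncomputable def diffTensor (ρ : M → ℝ) (θ : Form m M) : Tensor2 m M :=
  fun p => (mvfderiv (𝓡 m) ρ p).smulRight (θ p)

/-- `(L_X ρ)` for the vector field `X` dual to `T(θ♯, ·)`, written as `g(dρ ⊗ θ, T)`. -/
noncomputable def fluxDeriv (g T : Tensor2 m M) (θ : Form m M)
    (ρ : M → ℝ) : M → ℝ :=
  tensorInner g (diffTensor ρ θ) T

/-- The integral of a function that vanishes off the overlap of two charts can be computed in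
either of them. -/
lemma chartIntegral_eq_of_vanishing (he : e ∈ maximalAtlas (𝓡 m) ∞ M)
    (he' : e' ∈ maximalAtlas (𝓡 m) ∞ M) (g : Tensor2 m M) {u : M → ℝ}
    (hu : ∀ p, p ∉ e.source → u p = 0) (hu' : ∀ p, p ∉ e'.source → u p = 0) :
    chartIntegral g e u = chartIntegral g e' u := by
  set τ := e'.symm.trans e
  have hsrc : τ.source = e'.target ∩ e'.symm ⁻¹' e.source := by
    simp [τ]
  have htgt : τ.target = e.target ∩ e.symm ⁻¹' e'.source := by
    simp [τ]
  have h1 : chartIntegral g e u = ∫ x in τ.target, u (e.symm x) * √(tensorComp e g x).det := by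
    rw [chartIntegral]
    refine setIntegral_eq_of_subset_of_forall_sdiff_eq_zero e.open_target.measurableSet ?_ ?_
    · rw [htgt]; exact Set.inter_subset_left
    · intro x hx
      rw [hu' _ fun h => hx.2 (htgt ▸ ⟨hx.1, h⟩), zero_mul]
  have h2 : chartIntegral g e' u = ∫ x in τ.source, u (e'.symm x) * √(tensorComp e' g x).det := by
    rw [chartIntegral]
    refine setIntegral_eq_of_subset_of_forall_sdiff_eq_zero e'.open_target.measurableSet ?_ ?_
    · rw [hsrc]; exact Set.inter_subset_left
    · intro x hx
      rw [hu _ fun h => hx.2 (hsrc ▸ ⟨hx.1, h⟩), zero_mul]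
  have hder : ∀ x ∈ τ.source, HasFDerivAt τ (fderiv ℝ (e ∘ e'.symm) x) x := fun x hx => by
    rw [hsrc] at hx
    exact ((contDiffAt_transition he he' hx.1 hx.2).differentiableAt (by simp)).hasFDerivAt
  rw [h1, h2, integral_target_eq_integral_abs_det_fderiv_smul volume hder]
  refine setIntegral_congr_fun τ.open_source.measurableSet fun x hx => ?_
  rw [hsrc] at hx
  have hτ : τ x = e (e'.symm x) := rfl
  simp only [smul_eq_mul, hτ]
  rw [sqrt_det_transition he he' hx.1 hx.2, e.left_inv hx.2]
  ring

lemma tensorComp_diffTensor (he : e ∈ maximalAtlas (𝓡 m) ∞ M) (hx : x ∈ e.target) {ρ : M → ℝ}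
    (hρ : MDifferentiableAt (𝓡 m) 𝓘(ℝ) ρ (e.symm x)) (θ : Form m M) :
    tensorComp e (diffTensor ρ θ) x =
      Matrix.vecMulVec (fun i => pd i (ρ ∘ e.symm) x) (formComp e θ x) := by
  ext i j
  rw [Matrix.vecMulVec_apply, pd, ← mvfderiv_mfderiv_symm he hx hρ]
  rfl

lemma contDiffAt_comp_symm (he : e ∈ maximalAtlas (𝓡 m) ∞ M) (hx : x ∈ e.target) {ρ : M → ℝ}
    (hρ : ContMDiff (𝓡 m) 𝓘(ℝ) ∞ ρ) : ContDiffAt ℝ ∞ (ρ ∘ e.symm) x :=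
  (hρ.contMDiffAt.comp x (contMDiffAt_symm_of_mem_maximalAtlas he hx)).contDiffAt

variable [IsManifold (𝓡 m) ∞ M]

lemma fluxDeriv_eq {g T : Tensor2 m M} (hg : IsRiemannian g) (he : e ∈ maximalAtlas (𝓡 m) ∞ M)
    (hx : x ∈ e.target) {ρ : M → ℝ} (hρ : ContMDiff (𝓡 m) 𝓘(ℝ) ∞ ρ) (θ : Form m M) :
    fluxDeriv g T θ ρ (e.symm x) = ∑ i, pd i (ρ ∘ e.symm) x * ((tensorComp e g x)⁻¹ *ᵥ
      (tensorComp e T x *ᵥ ((tensorComp e g x)⁻¹ *ᵥ formComp e θ x))) i := by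
  rw [fluxDeriv, tensorInner_eq he hx,
    tensorComp_diffTensor he hx (hρ.contMDiffAt.mdifferentiableAt (by simp)),
    matInner_vecMulVec (hg.isMetricAt he hx).symm.self_of_nhds]

lemma fluxDeriv_eq_zero {g T : Tensor2 m M} (hg : IsRiemannian g) {ρ : M → ℝ}
    (hρ : ContMDiff (𝓡 m) 𝓘(ℝ) ∞ ρ) (θ : Form m M) {p : M} (hp : p ∉ tsupport ρ) :
    fluxDeriv g T θ ρ p = 0 := by
  set e := chartAt (EuclideanSpace ℝ (Fin m)) p
  have he : e ∈ maximalAtlas (𝓡 m) ∞ M := chart_mem_maximalAtlas p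
  have hps : p ∈ e.source := mem_chart_source _ p
  have hx := e.map_source hps
  rw [← e.left_inv hps, fluxDeriv_eq hg he hx hρ]
  refine Finset.sum_eq_zero fun i _ => ?_
  have h0 : ρ ∘ e.symm =ᶠ[𝓝 (e p)] fun _ => 0 := by
    have hc := e.continuousAt_symm hx
    rw [ContinuousAt, e.left_inv hps] at hc
    exact hc.eventually ((notMem_tsupport_iff_eventuallyEq.1 hp).mono fun q hq => hq)
  rw [pd_congr h0, pd_const, zero_mul]

/-- The data of the integration by parts `∫ |Sθ|² = -∫ θ(div Sθ)`: a divergence-free tensor `T` that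
is the Cauchy-Ahlfors tensor of the one-form `θ`. -/
structure IsDivFreeAhlfors (g T : Tensor2 m M) (θ : Form m M) : Prop where
  metric : IsRiemannian g
  form : SmoothForm θ
  eq : ∀ e ∈ maximalAtlas (𝓡 m) ∞ M, ∀ x ∈ e.target,
    tensorComp e T x = ahlfors (tensorComp e g) (formComp e θ) x
  div : ∀ e ∈ maximalAtlas (𝓡 m) ∞ M, ∀ x ∈ e.target, ∀ k,
    divTensor (tensorComp e g) (tensorComp e T) x k = 0

namespace IsDivFreeAhlfors

variable {g T : Tensor2 m M} {θ : Form m M}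

lemma eventually_isMetricAt (h : IsDivFreeAhlfors g T θ) (he : e ∈ maximalAtlas (𝓡 m) ∞ M)
    (hx : x ∈ e.target) : ∀ᶠ y in 𝓝 x, IsMetricAt (tensorComp e g) y := by
  filter_upwards [e.open_target.mem_nhds hx] with y hy using h.metric.isMetricAt he hy

lemma eventually_contDiffAt (h : IsDivFreeAhlfors g T θ) (he : e ∈ maximalAtlas (𝓡 m) ∞ M)
    (hx : x ∈ e.target) :
    ∀ᶠ y in 𝓝 x, ∀ j, ContDiffAt ℝ ∞ (fun z => formComp e θ z j) y := by
  filter_upwards [e.open_target.mem_nhds hx] with y hy j using contDiffAt_formComp h.form he hy j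

lemma eventually_eq (h : IsDivFreeAhlfors g T θ) (he : e ∈ maximalAtlas (𝓡 m) ∞ M)
    (hx : x ∈ e.target) :
    tensorComp e T =ᶠ[𝓝 x] ahlfors (tensorComp e g) (formComp e θ) := by
  filter_upwards [e.open_target.mem_nhds hx] with y hy using h.eq e he y hy

lemma smoothMat (h : IsDivFreeAhlfors g T θ) (he : e ∈ maximalAtlas (𝓡 m) ∞ M)
    (hx : x ∈ e.target) : SmoothMat (tensorComp e T) x := fun i j =>
  (IsMetricAt.smoothMat_ahlfors (h.eventually_isMetricAt he hx)
    (h.eventually_contDiffAt he hx) i j).congr_of_eventuallyEq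
      ((h.eventually_eq he hx).mono fun _ hy => congrFun (congrFun hy i) j)

lemma contDiffAt_sqrt_det (h : IsDivFreeAhlfors g T θ) (he : e ∈ maximalAtlas (𝓡 m) ∞ M)
    (hx : x ∈ e.target) : ContDiffAt ℝ ∞ (fun y => √(tensorComp e g y).det) x :=
  (contDiffAt_det (h.metric.smooth e he x hx)).sqrt (h.metric.isMetricAt he hx).det_pos.ne'

/-- The vector field dual to `T(θ♯, ·)` is smooth. -/
lemma contDiffAt_flux (h : IsDivFreeAhlfors g T θ) (he : e ∈ maximalAtlas (𝓡 m) ∞ M)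
    (hx : x ∈ e.target) (i : Fin m) : ContDiffAt ℝ ∞ (fun y => ((tensorComp e g y)⁻¹ *ᵥ
      (tensorComp e T y *ᵥ ((tensorComp e g y)⁻¹ *ᵥ formComp e θ y))) i) x := by
  have hinv := (h.metric.smooth e he x hx).inv (h.metric.isMetricAt he hx).det_pos.ne'
  exact contDiffAt_mulVec hinv (contDiffAt_mulVec (h.smoothMat he hx)
    (contDiffAt_mulVec hinv fun j => contDiffAt_formComp h.form he hx j)) i

lemma continuousAt_fluxDeriv (h : IsDivFreeAhlfors g T θ) (he : e ∈ maximalAtlas (𝓡 m) ∞ M)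
    (hx : x ∈ e.target) {ρ : M → ℝ} (hρ : ContMDiff (𝓡 m) 𝓘(ℝ) ∞ ρ) :
    ContinuousAt (fun y => fluxDeriv g T θ ρ (e.symm y)) x := by
  have hc : ContDiffAt ℝ ∞ (fun y => ∑ i, pd i (ρ ∘ e.symm) y * ((tensorComp e g y)⁻¹ *ᵥ
      (tensorComp e T y *ᵥ ((tensorComp e g y)⁻¹ *ᵥ formComp e θ y))) i) x :=
    ContDiffAt.sum fun i _ => ((contDiffAt_comp_symm he hx hρ).pd i).mul (h.contDiffAt_flux he hx i)
  refine hc.continuousAt.congr ?_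
  filter_upwards [e.open_target.mem_nhds hx] with y hy
  exact (fluxDeriv_eq h.metric he hy hρ θ).symm

lemma continuousAt_tensorInner (h : IsDivFreeAhlfors g T θ) (he : e ∈ maximalAtlas (𝓡 m) ∞ M)
    (hx : x ∈ e.target) : ContinuousAt (fun y => tensorInner g T T (e.symm y)) x := by
  have hinv := (h.metric.smooth e he x hx).inv (h.metric.isMetricAt he hx).det_pos.ne'
  have hT := h.smoothMat he hx
  have hc : ContDiffAt ℝ ∞ (fun y => matInner (tensorComp e g y) (tensorComp e T y)
      (tensorComp e T y)) x :=
    ContDiffAt.sum fun i _ => ContDiffAt.sum fun j _ => ContDiffAt.sum fun k _ =>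
      ContDiffAt.sum fun l _ => (((hinv i k).mul (hinv j l)).mul (hT i j)).mul (hT k l)
  refine hc.continuousAt.congr ?_
  filter_upwards [e.open_target.mem_nhds hx] with y hy
  exact (tensorInner_eq he hy g T T).symm

/-- Integration by parts in a chart: `∫ ρ |T|² = -∫ L_X ρ`. -/
lemma chartIntegral_mul_tensorInner [CompactSpace M] (h : IsDivFreeAhlfors g T θ) (hm : m ≠ 0)
    (he : e ∈ maximalAtlas (𝓡 m) ∞ M) {ρ : M → ℝ} (hρ : ContMDiff (𝓡 m) 𝓘(ℝ) ∞ ρ)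
    (hsupp : tsupport ρ ⊆ e.source) :
    chartIntegral g e (fun p => ρ p * tensorInner g T T p) =
      -chartIntegral g e (fluxDeriv g T θ ρ) := by
  obtain ⟨hK, hKt⟩ := isCompact_image_chart (isClosed_tsupport ρ).isCompact hsupp
  have key := setIntegral_sum_pd_mul e.open_target hK hKt (r := ρ ∘ e.symm)
    (Z := fun i y => √(tensorComp e g y).det * ((tensorComp e g y)⁻¹ *ᵥ
      (tensorComp e T y *ᵥ ((tensorComp e g y)⁻¹ *ᵥ formComp e θ y))) i)
    (fun x hx => contDiffAt_comp_symm he hx hρ)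
    (vanishing_comp_symm fun p hp => image_eq_zero_of_notMem_tsupport hp)
    (fun i x hx => (h.contDiffAt_sqrt_det he hx).mul (h.contDiffAt_flux he hx i))
  refine Eq.trans ?_ (key.trans (congrArg Neg.neg ?_))
  · refine setIntegral_congr_fun e.open_target.measurableSet fun x hx => ?_
    simp only [Function.comp_apply]
    rw [IsMetricAt.sum_pd_sqrt_det_mul (h.eventually_isMetricAt he hx) hm
      (h.eventually_contDiffAt he hx) (h.eventually_eq he hx) (h.div e he x hx),
      tensorInner_eq he hx]
    ring
  · refine setIntegral_congr_fun e.open_target.measurableSet fun x hx => ?_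
    rw [fluxDeriv_eq h.metric he hx hρ, Finset.sum_mul]
    exact Finset.sum_congr rfl fun i _ => by ring

/-- **Divergence theorem** for the vector field dual to `T(θ♯, ·)`, whose divergence is `|T|²`:
a divergence-free Cauchy-Ahlfors tensor on a compact manifold vanishes. -/
theorem tensorInner_self_eq_zero [CompactSpace M] [T2Space M] (h : IsDivFreeAhlfors g T θ)
    (hm : m ≠ 0) (p : M) : tensorInner g T T p = 0 := by
  obtain ⟨P, hP⟩ := SmoothPartitionOfUnity.exists_isSubordinate_chartAt_source (𝓡 m) M
  have hsm : ∀ c, ContMDiff (𝓡 m) 𝓘(ℝ) ∞ (P c) := fun c => (P c).contMDiff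
  have hat : ∀ c : M, chartAt (EuclideanSpace ℝ (Fin m)) c ∈ maximalAtlas (𝓡 m) ∞ M := fun c =>
    chart_mem_maximalAtlas c
  have hcpt : ∀ c, IsCompact (tsupport (P c)) := fun c => (isClosed_tsupport _).isCompact
  set s := (P.locallyFinite.finite_nonempty_of_compact).toFinset
  have hsum : ∀ q, ∑ c ∈ s, P c q = 1 := fun q => by
    rw [← P.sum_eq_one (Set.mem_univ q)]
    refine (finsum_eq_sum_of_support_subset _ fun c hc => ?_).symm
    exact (Set.Finite.mem_toFinset _).2 ⟨q, hc⟩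
  -- The sum of the `dP_c` is `d1 = 0`.
  have hflux : ∀ q, ∑ c ∈ s, fluxDeriv g T θ (P c) q = 0 := fun q => by
    set e := chartAt (EuclideanSpace ℝ (Fin m)) q
    have hq : q ∈ e.source := mem_chart_source _ q
    have hx := e.map_source hq
    rw [← e.left_inv hq]
    rw [Finset.sum_congr rfl fun c _ => fluxDeriv_eq h.metric (hat q) hx (hsm c) θ]
    rw [Finset.sum_comm]
    refine Finset.sum_eq_zero fun i _ => ?_
    rw [← Finset.sum_mul, ← pd_sum fun c _ =>
      (contDiffAt_comp_symm (hat q) hx (hsm c)).differentiableAt (by simp)]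
    have : (fun y => ∑ c ∈ s, (P c ∘ e.symm) y) = fun _ => 1 := funext fun y => hsum _
    rw [this, pd_const, zero_mul]
  set E := fun c : M => chartAt (EuclideanSpace ℝ (Fin m)) c
  -- `W c d` is supported in both charts. Summed over `d` it is the flux term of the chart `c`; its
  -- integral may be moved to the chart `d`, where the sum over `c` vanishes.
  set W := fun (c d q : M) => P d q * fluxDeriv g T θ (P c) q
  have hWc : ∀ c d q, q ∉ tsupport (P c) → W c d q = 0 := fun c d q hq => by
    simp only [W, fluxDeriv_eq_zero h.metric (hsm c) θ hq, mul_zero]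
  have hWd : ∀ c d q, q ∉ tsupport (P d) → W c d q = 0 := fun c d q hq => by
    simp only [W, image_eq_zero_of_notMem_tsupport hq, zero_mul]
  have hint : ∀ b c d, (∀ q, q ∉ tsupport (P b) → W c d q = 0) →
      IntegrableOn (fun x => W c d ((E b).symm x) * √(tensorComp (E b) g x).det)
        (E b).target := fun b c d hW => by
    obtain ⟨hK, hKt⟩ := isCompact_image_chart (hcpt b) (hP b)
    refine integrableOn_of_vanishing (E b).open_target hK hKt
      (fun x hx hxK => ?_) fun x hx => ContinuousAt.continuousWithinAt ?_
    · rw [vanishing_comp_symm hW x hx hxK, zero_mul]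
    · exact ((contDiffAt_comp_symm (hat b) hx (hsm d)).continuousAt.mul
        (h.continuousAt_fluxDeriv (hat b) hx (hsm c))).mul
        (h.contDiffAt_sqrt_det (hat b) hx).continuousAt
  have hsplit : ∀ c, chartIntegral g (E c) (fluxDeriv g T θ (P c)) =
      ∑ d ∈ s, chartIntegral g (E c) (W c d) := fun c => by
    simp only [chartIntegral]
    rw [← integral_finsetSum _ fun d _ => hint c c d (hWc c d)]
    refine setIntegral_congr_fun (E c).open_target.measurableSet fun x _ => ?_
    simp only [W]
    rw [← Finset.sum_mul, ← Finset.sum_mul, hsum, one_mul]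
  have hjoin : ∀ d, ∑ c ∈ s, chartIntegral g (E d) (W c d) = 0 := fun d => by
    simp only [chartIntegral]
    rw [← integral_finsetSum _ fun c _ => hint d c d (hWd c d)]
    refine setIntegral_eq_zero_of_forall_eq_zero fun x _ => ?_
    simp only [W]
    rw [← Finset.sum_mul, ← Finset.mul_sum, hflux, mul_zero, zero_mul]
  have htotal : ∑ c ∈ s, chartIntegral g (E c) (fun q => P c q * tensorInner g T T q) = 0 := by
    calc _ = -∑ c ∈ s, ∑ d ∈ s, chartIntegral g (E c) (W c d) := by
          rw [← Finset.sum_neg_distrib]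
          exact Finset.sum_congr rfl fun c _ => by
            rw [h.chartIntegral_mul_tensorInner hm (hat c) (hsm c) (hP c), hsplit]
      _ = -∑ d ∈ s, ∑ c ∈ s, chartIntegral g (E d) (W c d) := by
          rw [Finset.sum_comm]
          refine congrArg Neg.neg (Finset.sum_congr rfl fun d _ => Finset.sum_congr rfl fun c _ => ?_)
          exact chartIntegral_eq_of_vanishing (hat c) (hat d) g
            (fun q hq => hWc c d q fun hq' => hq (hP c hq'))
            (fun q hq => hWd c d q fun hq' => hq (hP d hq'))
      _ = 0 := by rw [Finset.sum_eq_zero fun d _ => hjoin d, neg_zero]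
  have hnn : ∀ q, 0 ≤ tensorInner g T T q := fun q =>
    matInner_self_nonneg (posDef_tensorComp (hat q) ((E q).map_source (mem_chart_source _ q))
      h.metric.symm h.metric.pos)
  have hnonneg : ∀ c, ∀ x ∈ (E c).target, 0 ≤ P c ((E c).symm x) *
      tensorInner g T T ((E c).symm x) * √(tensorComp (E c) g x).det := fun c x _ =>
    mul_nonneg (mul_nonneg (P.nonneg c _) (hnn _)) (Real.sqrt_nonneg _)
  have hzero : ∀ c ∈ s, P c p * tensorInner g T T p = 0 := fun c hc => by
    by_cases hp : p ∈ (E c).source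
    · obtain ⟨hK, hKt⟩ := isCompact_image_chart (hcpt c) (hP c)
      have hI := (Finset.sum_eq_zero_iff_of_nonneg fun c _ =>
        setIntegral_nonneg (E c).open_target.measurableSet (hnonneg c)).1 htotal c hc
      have hx := (E c).map_source hp
      have := eq_zero_of_setIntegral_eq_zero (h := fun x => P c ((E c).symm x) *
          tensorInner g T T ((E c).symm x) * √(tensorComp (E c) g x).det) (E c).open_target hK hKt
        (fun x hx hxK => by
          rw [vanishing_comp_symm (fun p hp => image_eq_zero_of_notMem_tsupport hp) x hx hxK,
            zero_mul, zero_mul])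
        (fun x hx => (((contDiffAt_comp_symm (hat c) hx (hsm c)).continuousAt.mul
          (h.continuousAt_tensorInner (hat c) hx)).mul
          (h.contDiffAt_sqrt_det (hat c) hx).continuousAt).continuousWithinAt)
        (hnonneg c) hI _ hx
      rw [(E c).left_inv hp] at this
      exact (mul_eq_zero.1 this).resolve_right
        (Real.sqrt_pos.2 (h.metric.isMetricAt (hat c) hx).det_pos).ne'
    · rw [image_eq_zero_of_notMem_tsupport fun h => hp (hP c h), zero_mul]
  rw [← one_mul (tensorInner g T T p), ← hsum p, Finset.sum_mul]
  exact Finset.sum_eq_zero hzero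

/-- A divergence-free Cauchy-Ahlfors tensor on a compact manifold vanishes. -/
theorem tensorComp_eq_zero [CompactSpace M] [T2Space M] (h : IsDivFreeAhlfors g T θ)
    (hm : m ≠ 0) (he : e ∈ maximalAtlas (𝓡 m) ∞ M) (hx : x ∈ e.target) : tensorComp e T x = 0 := by
  refine eq_zero_of_matInner_self_eq_zero
    (posDef_tensorComp he hx h.metric.symm h.metric.pos) ?_
  rw [← tensorInner_eq he hx, h.tensorInner_self_eq_zero hm]

end IsDivFreeAhlfors

end Divergence

/-! ### The Koszul expression for `g(∇_V N, W)` and its invariance -/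

section Koszul

variable {m : ℕ}

local notation "E" => EuclideanSpace ℝ (Fin m)

/-- The value `A(u, w)` of the bilinear form with matrix `A`. -/
noncomputable def bil (A : Matrix (Fin m) (Fin m) ℝ) (u w : E) : ℝ :=
  ∑ i, ∑ j, u i * w j * A i j

/-- The derivative in the direction `k` of `A(u, w)`, with `u` and `w` constant. -/
noncomputable def dbil (A : E → Matrix (Fin m) (Fin m) ℝ) (z k u w : E) : ℝ :=
  ∑ i, ∑ j, u i * w j * fderiv ℝ (fun y => A y i j) z k

/-- The value of `A(∇_V N, W)`, where `∇` is the Levi-Civita connection of `A`, for a vector field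
`N` along a map, with derivative `D` in the direction which the map takes to `V`. The lowered
Christoffel symbols are written out, so that no inverse of `A` appears. -/
noncomputable def koszul (A : E → Matrix (Fin m) (Fin m) ℝ) (z V N W D : E) : ℝ :=
  bil (A z) D W + 1 / 2 * (dbil A z V N W + dbil A z N V W - dbil A z W V N)

lemma bil_add_left (A : Matrix (Fin m) (Fin m) ℝ) (u v w : E) :
    bil A (u + v) w = bil A u w + bil A v w := by
  simp only [bil, PiLp.add_apply, add_mul, Finset.sum_add_distrib]

lemma bil_comm {A : Matrix (Fin m) (Fin m) ℝ} (hA : A.IsSymm) (u w : E) :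
    bil A u w = bil A w u := by
  rw [bil, bil, Finset.sum_comm]
  exact Finset.sum_congr rfl fun i _ => Finset.sum_congr rfl fun j _ => by
    rw [hA.apply i j]; ring

lemma fderiv_apply_coord {F : Type*} [NormedAddCommGroup F] [NormedSpace ℝ F] {u : F → E} {z : F}
    (hu : DifferentiableAt ℝ u z) (i : Fin m) (k : F) :
    fderiv ℝ (fun y => u y i) z k = fderiv ℝ u z k i := by
  have h := ((EuclideanSpace.proj i : E →L[ℝ] ℝ).hasFDerivAt.comp z hu.hasFDerivAt).fderiv
  exact congrArg (fun L : F →L[ℝ] ℝ => L k) h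

lemma differentiableAt_coord {F : Type*} [NormedAddCommGroup F] [NormedSpace ℝ F] {u : F → E}
    {z : F} (hu : DifferentiableAt ℝ u z) (i : Fin m) :
    DifferentiableAt ℝ (fun y => u y i) z :=
  (EuclideanSpace.proj i : E →L[ℝ] ℝ).differentiableAt.comp z hu

lemma fderiv_bil {A : E → Matrix (Fin m) (Fin m) ℝ} {u w : E → E} {z : E} (hA : DiffMat A z)
    (hu : DifferentiableAt ℝ u z) (hw : DifferentiableAt ℝ w z) (k : E) :
    fderiv ℝ (fun y => bil (A y) (u y) (w y)) z k = bil (A z) (fderiv ℝ u z k) (w z) +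
      bil (A z) (u z) (fderiv ℝ w z k) + dbil A z k (u z) (w z) := by
  have huc := differentiableAt_coord hu
  have hwc := differentiableAt_coord hw
  simp only [bil, dbil, ← Finset.sum_add_distrib]
  rw [fderiv_fun_sum fun i _ => DifferentiableAt.fun_sum fun j _ =>
    ((huc i).fun_mul (hwc j)).fun_mul (hA i j), _root_.sum_apply]
  refine Finset.sum_congr rfl fun i _ => ?_
  rw [fderiv_fun_sum fun j _ => ((huc i).fun_mul (hwc j)).fun_mul (hA i j), _root_.sum_apply]
  refine Finset.sum_congr rfl fun j _ => ?_
  rw [fderiv_fun_mul ((huc i).fun_mul (hwc j)) (hA i j), fderiv_fun_mul (huc i) (hwc j)]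
  simp only [_root_.add_apply, _root_.smul_apply, smul_eq_mul, fderiv_apply_coord hu,
    fderiv_apply_coord hw]
  ring

lemma dbil_eq_fderiv {A : E → Matrix (Fin m) (Fin m) ℝ} {z : E} (hA : DiffMat A z) (k u w : E) :
    dbil A z k u w = fderiv ℝ (fun y => bil (A y) u w) z k := by
  rw [fderiv_bil hA (differentiableAt_const u) (differentiableAt_const w)]
  simp [bil]

/-- The Koszul expression is invariant under a change of coordinates `ψ` that takes the metric `A` to
`A'`. The second derivative of `ψ` appears through the derivative of `y ↦ Dψ(N y)`. -/
lemma koszul_transition {A A' : E → Matrix (Fin m) (Fin m) ℝ} {ψ : E → E} {z : E}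
    (hψ : ContDiffAt ℝ ∞ ψ z) (hA : DiffMat A z) (hA' : DiffMat A' (ψ z))
    (hsymm : (A' (ψ z)).IsSymm)
    (h : ∀ᶠ y in 𝓝 z, ∀ u w, bil (A y) u w = bil (A' (ψ y)) (fderiv ℝ ψ y u) (fderiv ℝ ψ y w))
    (V N W D : E) :
    koszul A z V N W D = koszul A' (ψ z) (fderiv ℝ ψ z V) (fderiv ℝ ψ z N) (fderiv ℝ ψ z W)
      (fderiv ℝ (fderiv ℝ ψ) z V N + fderiv ℝ ψ z D) := by
  have hψ1 : DifferentiableAt ℝ ψ z := hψ.differentiableAt (by simp)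
  have hψ2 : DifferentiableAt ℝ (fderiv ℝ ψ) z :=
    (hψ.fderiv_right (m := 1) (by norm_cast)).differentiableAt one_ne_zero
  have hsnd : ∀ a b, fderiv ℝ (fderiv ℝ ψ) z a b = fderiv ℝ (fderiv ℝ ψ) z b a := fun a b =>
    (hψ.isSymmSndFDerivAt (by simpa using ENat.LEInfty.out)).eq a b
  have hcA : DiffMat (fun y => A' (ψ y)) z := fun i j => (hA' i j).comp z hψ1
  have hconst : ∀ u : E, DifferentiableAt ℝ (fun y => fderiv ℝ ψ y u) z := fun u =>
    hψ2.clm_apply (differentiableAt_const u)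
  have hd2 : ∀ k u : E, fderiv ℝ (fun y => fderiv ℝ ψ y u) z k = fderiv ℝ (fderiv ℝ ψ) z k u := by
    intro k u
    rw [fderiv_clm_apply hψ2 (differentiableAt_const u)]
    simp
  have hchain : ∀ k u w, dbil (fun y => A' (ψ y)) z k u w = dbil A' (ψ z) (fderiv ℝ ψ z k) u w := by
    intro k u w
    refine Finset.sum_congr rfl fun i _ => Finset.sum_congr rfl fun j _ => ?_
    congr 1
    exact congrArg (fun L : E →L[ℝ] ℝ => L k) (fderiv_comp z (hA' i j) hψ1)
  have hd : ∀ k u w, dbil A z k u w =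
      bil (A' (ψ z)) (fderiv ℝ (fderiv ℝ ψ) z k u) (fderiv ℝ ψ z w) +
      bil (A' (ψ z)) (fderiv ℝ ψ z u) (fderiv ℝ (fderiv ℝ ψ) z k w) +
      dbil A' (ψ z) (fderiv ℝ ψ z k) (fderiv ℝ ψ z u) (fderiv ℝ ψ z w) := by
    intro k u w
    have hev : (fun y => bil (A y) u w) =ᶠ[𝓝 z]
        fun y => bil (A' (ψ y)) (fderiv ℝ ψ y u) (fderiv ℝ ψ y w) := h.mono fun y hy => hy u w
    rw [dbil_eq_fderiv hA, hev.fderiv_eq, fderiv_bil hcA (hconst u) (hconst w), hd2, hd2, hchain]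
  rw [koszul, koszul, hd, hd, hd, h.self_of_nhds, bil_add_left, hsnd N V, hsnd W V, hsnd W N,
    bil_comm hsymm (fderiv ℝ ψ z V) (fderiv ℝ (fderiv ℝ ψ) z N W),
    bil_comm hsymm (fderiv ℝ ψ z N) (fderiv ℝ (fderiv ℝ ψ) z V W)]
  ring

lemma sum_mul_pd (u : E → ℝ) (z V : E) : ∑ b, V b * pd b u z = fderiv ℝ u z V := by
  have h1 : V = ∑ i, V i • (EuclideanSpace.single i (1 : ℝ) : E) := by
    ext k
    simp [Pi.single_apply]
  conv_rhs => rw [h1, map_sum]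
  simp [pd]

/-- The Koszul expression in terms of the Christoffel symbols. -/
lemma koszul_eq_christoffel {A : E → Matrix (Fin m) (Fin m) ℝ} {z : E} (hdet : IsUnit (A z).det)
    (hsymm : (A z).IsSymm) (V N W D : E) :
    koszul A z V N W D = ∑ a, ∑ b, A z a b *
      ((D a + ∑ c, ∑ d, christoffel A z a c d * N d * V c) * W b) := by
  have h1 : dbil A z V N W =
      ∑ b, ∑ c, ∑ d, W b * V c * N d * pd c (fun y => A y d b) z := by
    simp only [dbil, ← sum_mul_pd, Finset.mul_sum]
    rw [Finset.sum_comm]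
    refine Finset.sum_congr rfl fun b _ => ?_
    rw [Finset.sum_comm]
    exact Finset.sum_congr rfl fun c _ => Finset.sum_congr rfl fun d _ => by ring
  have h2 : dbil A z N V W =
      ∑ b, ∑ c, ∑ d, W b * V c * N d * pd d (fun y => A y c b) z := by
    simp only [dbil, ← sum_mul_pd, Finset.mul_sum]
    rw [Finset.sum_comm]
    exact Finset.sum_congr rfl fun b _ => Finset.sum_congr rfl fun c _ =>
      Finset.sum_congr rfl fun d _ => by ring
  have h3 : dbil A z W V N =
      ∑ b, ∑ c, ∑ d, W b * V c * N d * pd b (fun y => A y c d) z := by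
    simp only [dbil, ← sum_mul_pd, Finset.mul_sum]
    rw [Finset.sum_comm' (t' := Finset.univ) (s' := fun _ => Finset.univ) (by simp)]
    calc _ = ∑ d, ∑ b, ∑ c, W b * V c * N d * pd b (fun y => A y c d) z := by
          refine Finset.sum_congr rfl fun d _ => ?_
          rw [Finset.sum_comm]
          exact Finset.sum_congr rfl fun b _ => Finset.sum_congr rfl fun c _ => by ring
      _ = _ := by
          rw [Finset.sum_comm]
          exact Finset.sum_congr rfl fun b _ => Finset.sum_comm
  have h4 : ∀ b c d, ∑ a, A z a b * christoffel A z a c d = (1 / 2) *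
      (pd c (fun y => A y d b) z + pd d (fun y => A y c b) z - pd b (fun y => A y c d) z) := by
    intro b c d
    rw [← mul_christoffelMat hdet, Matrix.mul_apply]
    exact Finset.sum_congr rfl fun a _ => by rw [hsymm.apply a b]; rfl
  have h5 : ∑ a, ∑ b, A z a b * ((∑ c, ∑ d, christoffel A z a c d * N d * V c) * W b) =
      ∑ b, ∑ c, ∑ d, W b * V c * N d * ∑ a, A z a b * christoffel A z a c d := by
    simp only [Finset.mul_sum, Finset.sum_mul]
    rw [Finset.sum_comm]
    refine Finset.sum_congr rfl fun b _ => ?_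
    rw [Finset.sum_comm]
    refine Finset.sum_congr rfl fun c _ => ?_
    rw [Finset.sum_comm]
    exact Finset.sum_congr rfl fun d _ => Finset.sum_congr rfl fun a _ => by ring
  calc _ = bil (A z) D W +
        ∑ b, ∑ c, ∑ d, W b * V c * N d * ∑ a, A z a b * christoffel A z a c d := by
        simp only [koszul, h1, h2, h3, h4, ← Finset.sum_add_distrib, ← Finset.sum_sub_distrib,
          Finset.mul_sum]
        congr 1
        exact Finset.sum_congr rfl fun b _ => Finset.sum_congr rfl fun c _ =>
          Finset.sum_congr rfl fun d _ => by ring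
    _ = _ := by
        rw [← h5, bil]
        simp only [← Finset.sum_add_distrib]
        exact Finset.sum_congr rfl fun a _ => Finset.sum_congr rfl fun b _ => by ring

end Koszul

/-! ### Smoothness of the second fundamental form -/

section BilinearTransition

open IsManifold

variable {m : ℕ}

lemma bil_eq_dotProduct (A : Matrix (Fin m) (Fin m) ℝ) (u w : EuclideanSpace ℝ (Fin m)) :
    bil A u w = u.ofLp ⬝ᵥ (A *ᵥ w.ofLp) := by
  simp only [bil, dotProduct, Matrix.mulVec, Finset.mul_sum]
  exact Finset.sum_congr rfl fun i _ => Finset.sum_congr rfl fun j _ => by ring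

/-- Smoothness of the Koszul expression in all its arguments. -/
lemma contDiffAt_koszul {F : Type*} [NormedAddCommGroup F] [NormedSpace ℝ F]
    {A : EuclideanSpace ℝ (Fin m) → Matrix (Fin m) (Fin m) ℝ}
    {z V N W D : F → EuclideanSpace ℝ (Fin m)} {x : F} (hA : SmoothMat A (z x))
    (hz : ContDiffAt ℝ ∞ z x) (hV : ContDiffAt ℝ ∞ V x) (hN : ContDiffAt ℝ ∞ N x)
    (hW : ContDiffAt ℝ ∞ W x) (hD : ContDiffAt ℝ ∞ D x) :
    ContDiffAt ℝ ∞ (fun y => koszul A (z y) (V y) (N y) (W y) (D y)) x := by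
  have hc : ∀ {u : F → EuclideanSpace ℝ (Fin m)}, ContDiffAt ℝ ∞ u x → ∀ i,
      ContDiffAt ℝ ∞ (fun y => u y i) x := fun hu i =>
    (EuclideanSpace.proj i : EuclideanSpace ℝ (Fin m) →L[ℝ] ℝ).contDiff.contDiffAt.comp x hu
  have hd : ∀ {k u w : F → EuclideanSpace ℝ (Fin m)}, ContDiffAt ℝ ∞ k x → ContDiffAt ℝ ∞ u x →
      ContDiffAt ℝ ∞ w x → ContDiffAt ℝ ∞ (fun y => dbil A (z y) (k y) (u y) (w y)) x :=
    fun hk hu hw => ContDiffAt.sum fun i _ => ContDiffAt.sum fun j _ =>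
      ((hc hu i).mul (hc hw j)).mul
        ((((hA i j).fderiv_right (m := ∞) (by simp)).comp x hz).clm_apply hk)
  have hb : ContDiffAt ℝ ∞ (fun y => bil (A (z y)) (D y) (W y)) x :=
    ContDiffAt.sum fun i _ => ContDiffAt.sum fun j _ =>
      ((hc hD i).mul (hc hW j)).mul ((hA i j).comp x hz)
  exact hb.add (contDiffAt_const.mul (((hd hV hN hW).add (hd hN hV hW)).sub (hd hW hV hN)))

variable {L : Type*} [TopologicalSpace L] [ChartedSpace (EuclideanSpace ℝ (Fin m)) L]
  {e e' : OpenPartialHomeomorph L (EuclideanSpace ℝ (Fin m))}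

lemma bil_tensorComp_transition (he : e ∈ maximalAtlas (𝓡 m) ∞ L)
    (he' : e' ∈ maximalAtlas (𝓡 m) ∞ L) {x : EuclideanSpace ℝ (Fin m)} (hx : x ∈ e'.target)
    (hx' : e'.symm x ∈ e.source) (T : Tensor2 m L) (u w : EuclideanSpace ℝ (Fin m)) :
    bil (tensorComp e' T x) u w = bil (tensorComp e T (e (e'.symm x)))
      (fderiv ℝ (e ∘ e'.symm) x u) (fderiv ℝ (e ∘ e'.symm) x w) := by
  have hJ : ∀ u : EuclideanSpace ℝ (Fin m),
      jacobian e e' x *ᵥ u.ofLp = (fderiv ℝ (e ∘ e'.symm) x u).ofLp := fun u => by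
    have := LinearMap.toMatrix_mulVec_repr (EuclideanSpace.basisFun (Fin m) ℝ).toBasis
      (EuclideanSpace.basisFun (Fin m) ℝ).toBasis (fderiv ℝ (e ∘ e'.symm) x).toLinearMap u
    exact this
  rw [tensorComp_transition he he' hx hx', bil_eq_dotProduct, bil_eq_dotProduct, ← hJ, ← hJ,
    ← Matrix.mulVec_mulVec, ← Matrix.mulVec_mulVec, Matrix.dotProduct_mulVec,
    Matrix.vecMul_transpose]

/-- The derivative of a change of charts, in terms of the derivatives of the charts. -/
lemma mvfderiv_chart_transition (he : e ∈ maximalAtlas (𝓡 m) ∞ L)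
    (he' : e' ∈ maximalAtlas (𝓡 m) ∞ L) {q : L} (hq : q ∈ e.source) (hq' : q ∈ e'.source)
    (u : TangentSpace (𝓡 m) q) :
    mvfderiv (𝓡 m) e' q u = fderiv ℝ (e' ∘ e.symm) (e q) (mvfderiv (𝓡 m) e q u) := by
  have hψ := (contDiffAt_transition he' he (e.map_source hq)
    (by rwa [e.left_inv hq])).differentiableAt (by simp)
  have h1 : HasMFDerivAt (𝓡 m) (𝓡 m) e q (mfderiv (𝓡 m) (𝓡 m) e q) :=
    ((contMDiffAt_of_mem_maximalAtlas he hq).mdifferentiableAt (by simp)).hasMFDerivAt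
  have h2 := hψ.hasFDerivAt.hasMFDerivAt.comp q h1
  have hev : e' =ᶠ[𝓝 q] (e' ∘ e.symm) ∘ e := by
    filter_upwards [e.open_source.mem_nhds hq] with y hy
    simp [e.left_inv hy]
  have h3 := (h2.congr_of_eventuallyEq hev).mfderiv
  exact congrArg (fun A : EuclideanSpace ℝ (Fin m) →L[ℝ] EuclideanSpace ℝ (Fin m) => A u) h3

variable [IsManifold (𝓡 m) ∞ L]

/-- A smooth vector field along a map has smooth components in a chart. -/
lemma contMDiffAt_vectorField_along {n : ℕ} {M : Type*} [TopologicalSpace M]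
    [ChartedSpace (EuclideanSpace ℝ (Fin n)) M] {f : M → L} {N : ∀ p, TangentSpace (𝓡 m) (f p)}
    (he : e ∈ maximalAtlas (𝓡 m) ∞ L) {p : M} (hp : f p ∈ e.source)
    (hN : ContMDiffAt (𝓡 n) (𝓡 m).tangent ∞ (fun p => (⟨f p, N p⟩ : TangentBundle (𝓡 m) L)) p) :
    ContMDiffAt (𝓡 n) 𝓘(ℝ, EuclideanSpace ℝ (Fin m)) ∞
      (fun q => mvfderiv (𝓡 m) e (f q) (N q)) p := by
  have : IsManifold (𝓡 m) 1 L := IsManifold.of_le (n := ∞) (by simp)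
  have hf : ContMDiffAt (𝓡 n) (𝓡 m) ∞ f p := (Bundle.contMDiffAt_totalSpace.1 hN).1
  have h1 := (contMDiffOn_of_mem_maximalAtlas he).contMDiffOn_tangentMapWithin
    (m := ∞) (by simp) e.open_source.uniqueMDiffOn
  have h2 : ContMDiffAt (𝓡 m).tangent (𝓡 m).tangent ∞
      (tangentMapWithin (𝓡 m) (𝓡 m) e e.source) (⟨f p, N p⟩ : TangentBundle (𝓡 m) L) :=
    h1.contMDiffAt ((e.open_source.preimage (FiberBundle.continuous_proj _ _)).mem_nhds hp)
  have h3 := (contMDiff_snd_tangentBundle_modelSpace (EuclideanSpace ℝ (Fin m))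
    𝓘(ℝ, EuclideanSpace ℝ (Fin m)) (n := ∞)).contMDiffAt.comp p (h2.comp p hN)
  refine h3.congr_of_eventuallyEq ?_
  filter_upwards [hf.continuousAt.preimage_mem_nhds (e.open_source.mem_nhds hp)] with q hq
  have h4 := tangentMapWithin_eq_tangentMap (p := (⟨f q, N q⟩ : TangentBundle (𝓡 m) L))
    (e.open_source.uniqueMDiffOn _ hq)
    ((contMDiffAt_of_mem_maximalAtlas he hq).mdifferentiableAt (by simp))
  exact (congrArg (fun z : TangentBundle (𝓡 m) (EuclideanSpace ℝ (Fin m)) =>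
    (z.2 : EuclideanSpace ℝ (Fin m))) h4).symm

end BilinearTransition

section Hypersurface

open IsManifold

variable {n : ℕ} {M : Type*} [TopologicalSpace M] [ChartedSpace (EuclideanSpace ℝ (Fin n)) M]
  {L : Type*} [TopologicalSpace L] [ChartedSpace (EuclideanSpace ℝ (Fin (n + 1))) L]
  [IsManifold (𝓡 (n + 1)) ∞ L] {gL : LorentzianMetric (n + 1) L} {f : M → L}
  {N : ∀ p : M, TangentSpace (𝓡 (n + 1)) (f p)}

lemma LorentzianMetric.isSymm_tensorComp (gL : LorentzianMetric (n + 1) L)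
    (e : OpenPartialHomeomorph L (EuclideanSpace ℝ (Fin (n + 1))))
    (x : EuclideanSpace ℝ (Fin (n + 1))) : (tensorComp e gL.val x).IsSymm :=
  Matrix.IsSymm.ext fun _ _ => gL.symm _ _ _

/-- Lorentzian metrics are nondegenerate: a nonzero vector `u` in the kernel would be orthogonal
to the timelike `v` of the signature condition, hence spacelike. -/
lemma LorentzianMetric.isUnit_det_tensorComp (gL : LorentzianMetric (n + 1) L)
    {e : OpenPartialHomeomorph L (EuclideanSpace ℝ (Fin (n + 1)))}
    (he : e ∈ maximalAtlas (𝓡 (n + 1)) ∞ L) {x : EuclideanSpace ℝ (Fin (n + 1))}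
    (hx : x ∈ e.target) : IsUnit (tensorComp e gL.val x).det := by
  refine isUnit_iff_ne_zero.2 fun h0 => ?_
  obtain ⟨a, ha, hGa⟩ := Matrix.exists_mulVec_eq_zero_iff.2 h0
  obtain ⟨v, hv, hpos⟩ := gL.signature (e.symm x)
  have hbij := mfderiv_symm_bijective he hx
  set u := mfderiv (𝓡 (n + 1)) (𝓡 (n + 1)) e.symm x (WithLp.toLp 2 a)
  have hu : u ≠ 0 := fun h => ha <| by
    have := hbij.1 (h.trans (map_zero _).symm)
    exact congrArg WithLp.ofLp this
  have hnull : ∀ w, gL.val (e.symm x) w u = 0 := fun w => by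
    obtain ⟨b, rfl⟩ := hbij.2 w
    refine (tensor_apply_mfderiv_symm gL.val b (WithLp.toLp 2 a)).trans ?_
    refine (bil_eq_dotProduct (tensorComp e gL.val x) b (WithLp.toLp 2 a)).trans ?_
    exact (congrArg _ hGa).trans (dotProduct_zero _)
  exact (hpos u (hnull v) hu).ne' (hnull u)

/-- The second fundamental form computed in the chart `e` of the ambient manifold. -/
noncomputable def sffIn (gL : LorentzianMetric (n + 1) L)
    (e : OpenPartialHomeomorph L (EuclideanSpace ℝ (Fin (n + 1)))) (f : M → L)
    (N : ∀ p : M, TangentSpace (𝓡 (n + 1)) (f p)) : Tensor2 n M := fun p =>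
  ∑ a, ∑ b, tensorComp e gL.val (e (f p)) a b •
    (covDerivAlong gL e f N p a).smulRight (dCoord e f p b)

/-- The vector field `N` along `f`, expressed in a chart `c` of the source and a chart `e` of the
target. -/
noncomputable def localField (c : OpenPartialHomeomorph M (EuclideanSpace ℝ (Fin n)))
    (e : OpenPartialHomeomorph L (EuclideanSpace ℝ (Fin (n + 1)))) (f : M → L)
    (N : ∀ p : M, TangentSpace (𝓡 (n + 1)) (f p)) (x : EuclideanSpace ℝ (Fin n)) :
    EuclideanSpace ℝ (Fin (n + 1)) :=
  mvfderiv (𝓡 (n + 1)) e (f (c.symm x)) (N (c.symm x))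

variable {c : OpenPartialHomeomorph M (EuclideanSpace ℝ (Fin n))}
  {e e' : OpenPartialHomeomorph L (EuclideanSpace ℝ (Fin (n + 1)))}
  {x : EuclideanSpace ℝ (Fin n)}

namespace IsSpacelikeHypersurface

lemma contDiffAt_localMap (hf : IsSpacelikeHypersurface gL f N)
    (hc : c ∈ maximalAtlas (𝓡 n) ∞ M) (he : e ∈ maximalAtlas (𝓡 (n + 1)) ∞ L) (hx : x ∈ c.target)
    (hfx : f (c.symm x) ∈ e.source) : ContDiffAt ℝ ∞ (e ∘ f ∘ c.symm) x :=
  ((contMDiffAt_of_mem_maximalAtlas he hfx).comp x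
    (hf.smooth.contMDiffAt.comp x (contMDiffAt_symm_of_mem_maximalAtlas hc hx))).contDiffAt

lemma contDiffAt_localField (hf : IsSpacelikeHypersurface gL f N)
    (hc : c ∈ maximalAtlas (𝓡 n) ∞ M) (he : e ∈ maximalAtlas (𝓡 (n + 1)) ∞ L) (hx : x ∈ c.target)
    (hfx : f (c.symm x) ∈ e.source) : ContDiffAt ℝ ∞ (localField c e f N) x :=
  ((contMDiffAt_vectorField_along he hfx hf.smooth_normal.contMDiffAt).comp x
    (contMDiffAt_symm_of_mem_maximalAtlas hc hx)).contDiffAt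

lemma eventually_mem_source (hf : IsSpacelikeHypersurface gL f N)
    (hx : x ∈ c.target) (hfx : f (c.symm x) ∈ e.source) :
    ∀ᶠ y in 𝓝 x, y ∈ c.target ∧ f (c.symm y) ∈ e.source := by
  have hcont : ContinuousAt (fun y => f (c.symm y)) x :=
    hf.smooth.continuous.continuousAt.comp (c.continuousAt_symm hx)
  filter_upwards [c.open_target.mem_nhds hx,
    hcont.preimage_mem_nhds (e.open_source.mem_nhds hfx)] with y hy hy' using ⟨hy, hy'⟩

/-- The second fundamental form as a Koszul expression in charts of the source and the target. -/
lemma sffIn_apply (hf : IsSpacelikeHypersurface gL f N) (hc : c ∈ maximalAtlas (𝓡 n) ∞ M)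
    (he : e ∈ maximalAtlas (𝓡 (n + 1)) ∞ L) (hx : x ∈ c.target) (hfx : f (c.symm x) ∈ e.source)
    (a b : EuclideanSpace ℝ (Fin n)) :
    sffIn gL e f N (c.symm x) (mfderiv (𝓡 n) (𝓡 n) c.symm x a) (mfderiv (𝓡 n) (𝓡 n) c.symm x b) =
      koszul (tensorComp e gL.val) (e (f (c.symm x))) (fderiv ℝ (e ∘ f ∘ c.symm) x a)
        (localField c e f N x) (fderiv ℝ (e ∘ f ∘ c.symm) x b)
        (fderiv ℝ (localField c e f N) x a) := by
  have hproj : ∀ (u : M → EuclideanSpace ℝ (Fin (n + 1))) (k : Fin (n + 1)),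
      ContMDiffAt (𝓡 n) 𝓘(ℝ, EuclideanSpace ℝ (Fin (n + 1))) ∞ u (c.symm x) →
      MDifferentiableAt (𝓡 n) 𝓘(ℝ) (fun q => u q k) (c.symm x) := fun u k hu =>
    ((EuclideanSpace.proj k : EuclideanSpace ℝ (Fin (n + 1)) →L[ℝ] ℝ).contMDiff.contMDiffAt.comp
      (c.symm x) hu).mdifferentiableAt (by simp)
  have hdF : ∀ k (a : EuclideanSpace ℝ (Fin n)), dCoord e f (c.symm x) k
      (mfderiv (𝓡 n) (𝓡 n) c.symm x a) = fderiv ℝ (e ∘ f ∘ c.symm) x a k := fun k a => by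
    rw [dCoord, mvfderiv_mfderiv_symm hc hx (hproj (fun q => e (f q)) k
      ((contMDiffAt_of_mem_maximalAtlas he hfx).comp _ hf.smooth.contMDiffAt)),
      ← fderiv_apply_coord ((hf.contDiffAt_localMap hc he hx hfx).differentiableAt (by simp))]
    rfl
  have hdN : ∀ k, mvfderiv (𝓡 n) (vecComp e f N k) (c.symm x)
      (mfderiv (𝓡 n) (𝓡 n) c.symm x a) = fderiv ℝ (localField c e f N) x a k := fun k => by
    refine (mvfderiv_mfderiv_symm hc hx (hproj (fun q => mvfderiv (𝓡 (n + 1)) e (f q) (N q)) k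
      (contMDiffAt_vectorField_along he hfx hf.smooth_normal.contMDiffAt)) a).trans ?_
    rw [← fderiv_apply_coord ((hf.contDiffAt_localField hc he hx hfx).differentiableAt (by simp))]
    rfl
  rw [koszul_eq_christoffel (gL.isUnit_det_tensorComp he (e.map_source hfx))
    (gL.isSymm_tensorComp e _)]
  simp only [sffIn, covDerivAlong, _root_.sum_apply, _root_.smul_apply, _root_.add_apply,
    ContinuousLinearMap.smulRight_apply, smul_eq_mul, hdF, hdN]
  rfl

/-- The second fundamental form can be computed in any chart of the ambient manifold. -/
lemma sffIn_eq_sffIn [IsManifold (𝓡 n) ∞ M] (hf : IsSpacelikeHypersurface gL f N)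
    (he : e ∈ maximalAtlas (𝓡 (n + 1)) ∞ L) (he' : e' ∈ maximalAtlas (𝓡 (n + 1)) ∞ L) {p : M}
    (hp : f p ∈ e.source) (hp' : f p ∈ e'.source) : sffIn gL e f N p = sffIn gL e' f N p := by
  obtain ⟨c, hc, hpc⟩ : ∃ c ∈ maximalAtlas (𝓡 n) ∞ M, p ∈ c.source :=
    ⟨chartAt _ p, chart_mem_maximalAtlas p, mem_chart_source _ p⟩
  obtain ⟨x, hx, rfl⟩ : ∃ x ∈ c.target, c.symm x = p := ⟨c p, c.map_source hpc, c.left_inv hpc⟩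
  set ψ := e' ∘ e.symm
  set F := e ∘ f ∘ c.symm
  have hFx : F x ∈ e.target := e.map_source hp
  have hFx' : e.symm (F x) ∈ e'.source := by
    simpa [F, e.left_inv hp] using hp'
  have hψ : ContDiffAt ℝ ∞ ψ (F x) := contDiffAt_transition he' he hFx hFx'
  have hψF : ψ (F x) = e' (f (c.symm x)) := by simp [ψ, F, e.left_inv hp]
  have hF := (hf.contDiffAt_localMap hc he hx hp).differentiableAt (by simp)
  have hν := (hf.contDiffAt_localField hc he hx hp).differentiableAt (by simp)
  have hev := (hf.eventually_mem_source hx hp).and (hf.eventually_mem_source hx hp')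
  have hF' : e' ∘ f ∘ c.symm =ᶠ[𝓝 x] ψ ∘ F := by
    filter_upwards [hev] with y hy
    simp [ψ, F, e.left_inv hy.1.2]
  have hν' : localField c e' f N =ᶠ[𝓝 x] fun y => fderiv ℝ ψ (F y) (localField c e f N y) := by
    filter_upwards [hev] with y hy
    exact mvfderiv_chart_transition he he' hy.1.2 hy.2.2 _
  -- Differentiating `hν'` produces the second derivative of `ψ` in `koszul_transition`.
  have hdψ : DifferentiableAt ℝ (fderiv ℝ ψ) (F x) :=
    (hψ.fderiv_right (m := 1) (by norm_cast)).differentiableAt one_ne_zero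
  have hdF' : ∀ a, fderiv ℝ (e' ∘ f ∘ c.symm) x a = fderiv ℝ ψ (F x) (fderiv ℝ F x a) := fun a => by
    rw [hF'.fderiv_eq, fderiv_comp x (hψ.differentiableAt (by simp)) hF]
    rfl
  have hdν' : ∀ a, fderiv ℝ (localField c e' f N) x a =
      fderiv ℝ (fderiv ℝ ψ) (F x) (fderiv ℝ F x a) (localField c e f N x) +
      fderiv ℝ ψ (F x) (fderiv ℝ (localField c e f N) x a) := fun a => by
    rw [hν'.fderiv_eq, fderiv_clm_apply (c := fun y => fderiv ℝ ψ (F y)) (hdψ.comp x hF) hν]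
    have h1 : fderiv ℝ (fun y => fderiv ℝ ψ (F y)) x =
        (fderiv ℝ (fderiv ℝ ψ) (F x)).comp (fderiv ℝ F x) := fderiv_comp x hdψ hF
    rw [h1]
    simp [add_comm]
  have hbil : ∀ᶠ y in 𝓝 (F x), ∀ u w, bil (tensorComp e gL.val y) u w =
      bil (tensorComp e' gL.val (ψ y)) (fderiv ℝ ψ y u) (fderiv ℝ ψ y w) := by
    filter_upwards [e.open_target.mem_nhds hFx,
      (e.continuousAt_symm hFx).preimage_mem_nhds (e'.open_source.mem_nhds hFx')] with y hy hy' u w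
    exact bil_tensorComp_transition he' he hy hy' gL.val u w
  have hkoszul : ∀ a b : EuclideanSpace ℝ (Fin n),
      koszul (tensorComp e gL.val) (F x) (fderiv ℝ F x a) (localField c e f N x)
        (fderiv ℝ F x b) (fderiv ℝ (localField c e f N) x a) =
      koszul (tensorComp e' gL.val) (e' (f (c.symm x))) (fderiv ℝ (e' ∘ f ∘ c.symm) x a)
        (localField c e' f N x) (fderiv ℝ (e' ∘ f ∘ c.symm) x b)
        (fderiv ℝ (localField c e' f N) x a) := fun a b => by
    rw [hdF', hdF', hdν', hν'.self_of_nhds, ← hψF]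
    exact koszul_transition hψ (smoothMat_tensorComp gL.smooth he hFx).diffMat
      (hψF ▸ (smoothMat_tensorComp gL.smooth he' (e'.map_source hp')).diffMat)
      (gL.isSymm_tensorComp e' _) hbil _ _ _ _
  ext v w
  obtain ⟨a, rfl⟩ := (mfderiv_symm_bijective hc hx).2 v
  obtain ⟨b, rfl⟩ := (mfderiv_symm_bijective hc hx).2 w
  exact (hf.sffIn_apply hc he hx hp a b).trans
    ((hkoszul a b).trans (hf.sffIn_apply hc he' hx hp' a b).symm)

variable [IsManifold (𝓡 n) ∞ M]

/-- The components of the second fundamental form are smooth. -/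
theorem smoothMat_secondFundamentalForm (hf : IsSpacelikeHypersurface gL f N)
    (hc : c ∈ maximalAtlas (𝓡 n) ∞ M) (hx : x ∈ c.target) :
    SmoothMat (tensorComp c (secondFundamentalForm gL f N)) x := by
  intro i j
  set e := chartAt (EuclideanSpace ℝ (Fin (n + 1))) (f (c.symm x))
  have he : e ∈ maximalAtlas (𝓡 (n + 1)) ∞ L := chart_mem_maximalAtlas _
  have hfx : f (c.symm x) ∈ e.source := mem_chart_source _ _
  have hF := hf.contDiffAt_localMap hc he hx hfx
  have hν := hf.contDiffAt_localField hc he hx hfx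
  have hsm : ContDiffAt ℝ ∞ (fun y => koszul (tensorComp e gL.val) ((e ∘ f ∘ c.symm) y)
      (fderiv ℝ (e ∘ f ∘ c.symm) y (EuclideanSpace.single i 1)) (localField c e f N y)
      (fderiv ℝ (e ∘ f ∘ c.symm) y (EuclideanSpace.single j 1))
      (fderiv ℝ (localField c e f N) y (EuclideanSpace.single i 1))) x :=
    contDiffAt_koszul (smoothMat_tensorComp gL.smooth he (e.map_source hfx)) hF
      ((hF.fderiv_right (m := ∞) (by simp)).clm_apply contDiffAt_const) hν
      ((hF.fderiv_right (m := ∞) (by simp)).clm_apply contDiffAt_const)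
      ((hν.fderiv_right (m := ∞) (by simp)).clm_apply contDiffAt_const)
  refine hsm.congr_of_eventuallyEq ?_
  filter_upwards [hf.eventually_mem_source hx hfx] with y hy
  -- The definition at `c.symm y` uses the preferred chart around `f (c.symm y)`, not `e`.
  have h1 : secondFundamentalForm gL f N (c.symm y) = sffIn gL e f N (c.symm y) :=
    hf.sffIn_eq_sffIn (chart_mem_maximalAtlas _) he (mem_chart_source _ _) hy.2
  refine Eq.trans ?_ (hf.sffIn_apply hc he hy.1 hy.2 _ _)
  simp only [tensorComp, Matrix.of_apply]
  rw [h1]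
  rfl

/-- The mean curvature is smooth. -/
theorem contDiffAt_meanCurvature (hf : IsSpacelikeHypersurface gL f N)
    (hg : IsRiemannian (inducedMetric gL f)) (hc : c ∈ maximalAtlas (𝓡 n) ∞ M) (hx : x ∈ c.target) :
    ContDiffAt ℝ ∞ (fun y => meanCurvature gL f N (c.symm y)) x := by
  have hinv := (hg.smooth c hc x hx).inv (hg.isMetricAt hc hx).det_pos.ne'
  have hK := hf.smoothMat_secondFundamentalForm hc hx
  have hsm : ContDiffAt ℝ ∞ (fun y => matTrace (tensorComp c (inducedMetric gL f) y)
      (tensorComp c (secondFundamentalForm gL f N) y)) x :=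
    ContDiffAt.sum fun i _ => ContDiffAt.sum fun j _ => (hinv i j).mul (hK i j)
  refine hsm.congr_of_eventuallyEq ?_
  filter_upwards [c.open_target.mem_nhds hx] with y hy using traceTensor_eq hc hy _ _

/-- The induced metric of a spacelike hypersurface is a Riemannian metric. -/
lemma isRiemannian_inducedMetric (hf : IsSpacelikeHypersurface gL f N) :
    IsRiemannian (inducedMetric gL f) where
  symm p v w := gL.symm _ _ _
  pos := hf.spacelike
  smooth c hc x hx i j := by
    have : IsManifold (𝓡 n) 1 M := IsManifold.of_le (n := ∞) (by simp)
    have : IsManifold (𝓡 (n + 1)) 1 L := IsManifold.of_le (n := ∞) (by simp)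
    have h := hf.smooth.contMDiff_tangentMap (m := ∞) (by simp)
    exact (contMDiffAt_tensor_apply (b := fun y => f (c.symm y))
      (v := fun y => mfderiv (𝓡 n) (𝓡 (n + 1)) f (c.symm y) (coordVec c y i))
      (w := fun y => mfderiv (𝓡 n) (𝓡 (n + 1)) f (c.symm y) (coordVec c y j)) gL.smooth
      (h.contMDiffAt.comp x (contMDiffAt_coordVec hc hx i))
      (h.contMDiffAt.comp x (contMDiffAt_coordVec hc hx j))).contDiffAt

end IsSpacelikeHypersurface

end Hypersurface

/-! ### The momentum constraint and constancy of the mean curvature -/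

lemma divTensor_smul_metric_add {m : ℕ} {x : EuclideanSpace ℝ (Fin m)}
    {G A : EuclideanSpace ℝ (Fin m) → Matrix (Fin m) (Fin m) ℝ} (hG : IsMetricAt G x)
    {u : EuclideanSpace ℝ (Fin m) → ℝ} (hu : DifferentiableAt ℝ u x) (hA : DiffMat A x)
    (k : Fin m) :
    divTensor G (fun y => u y • G y + A y) x k = pd k u x + divTensor G A x k := by
  rw [divTensor_add (A := fun y => u y • G y) (fun i j => hu.fun_mul (hG.smooth.diffMat i j)) hA,
    divTensor_smul_metric hG hu]

/-- On a connected manifold, a function whose partial derivatives vanish in all charts is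
constant. -/
theorem exists_eq_const_of_pd_eq_zero {m : ℕ} {M : Type*} [TopologicalSpace M]
    [ChartedSpace (EuclideanSpace ℝ (Fin m)) M] [IsManifold (𝓡 m) ∞ M] [ConnectedSpace M]
    {u : M → ℝ}
    (hu : ∀ e ∈ IsManifold.maximalAtlas (𝓡 m) ∞ M, ∀ x ∈ e.target,
      DifferentiableAt ℝ (u ∘ e.symm) x ∧ ∀ k, pd k (u ∘ e.symm) x = 0) :
    ∃ c : ℝ, ∀ p, u p = c := by
  have hloc : IsLocallyConstant u := by
    refine (IsLocallyConstant.iff_eventually_eq u).2 fun p => ?_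
    set e := chartAt (EuclideanSpace ℝ (Fin m)) p
    have he : e ∈ IsManifold.maximalAtlas (𝓡 m) ∞ M := IsManifold.chart_mem_maximalAtlas p
    have hp : p ∈ e.source := mem_chart_source _ p
    obtain ⟨r, hr, hball⟩ := Metric.isOpen_iff.1 e.open_target (e p) (e.map_source hp)
    have hzero : ∀ y ∈ Metric.ball (e p) r, fderiv ℝ (u ∘ e.symm) y = 0 := fun y hy => by
      ext v
      rw [← sum_mul_pd]
      exact Finset.sum_eq_zero fun k _ => by rw [(hu e he y (hball hy)).2 k, mul_zero]
    filter_upwards [e.open_source.mem_nhds hp,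
      (e.continuousAt hp).preimage_mem_nhds (Metric.ball_mem_nhds _ hr)] with q hq hqr
    have h := Metric.isOpen_ball.is_const_of_fderiv_eq_zero (convex_ball (e p) r).isPreconnected
      (fun y hy => (hu e he y (hball hy)).1.differentiableWithinAt) hzero hqr
      (Metric.mem_ball_self hr)
    simpa [e.left_inv hq, e.left_inv hp] using h
  obtain ⟨p₀⟩ := (inferInstance : Nonempty M)
  exact ⟨u p₀, fun p => hloc.apply_eq_of_isPreconnected isPreconnected_univ trivial trivial⟩

section Constraint

variable {m : ℕ} {M : Type*} [TopologicalSpace M] [ChartedSpace (EuclideanSpace ℝ (Fin m)) M]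
  [IsManifold (𝓡 m) ∞ M] {g K φ : Tensor2 m M} {θ : Form m M}

/-- If the trace of `K` is constant, then the momentum constraint says that `K` is divergence-free.
Hence so is the Cauchy-Ahlfors part of its traceless part, and it vanishes. -/
theorem eq_add_of_trace_eq_const [T2Space M] [CompactSpace M] (hm : m ≠ 0) (hg : IsRiemannian g)
    (hdec : IsAhlforsDecomposition g (tracelessPart g K) θ φ) (hvac : VacuumConstraints g K)
    {c : ℝ} (hc : ∀ p, traceTensor g K p = c) (p : M) :
    K p = (1 / (m : ℝ) * traceTensor g K p) • g p + φ p := by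
  set T : Tensor2 m M := fun p => tracelessPart g K p - φ p
  have hT : ∀ (e : OpenPartialHomeomorph M (EuclideanSpace ℝ (Fin m))) x,
      tensorComp e T x = tensorComp e (tracelessPart g K) x - tensorComp e φ x := fun e x => rfl
  have hK : ∀ (e : OpenPartialHomeomorph M (EuclideanSpace ℝ (Fin m))), tensorComp e K =
      fun x => (c / m) • tensorComp e g x + (tensorComp e T x + tensorComp e φ x) := fun e => by
    funext x
    ext i j
    have h : tensorComp e (tracelessPart g K) x i j =
        tensorComp e K x i j - traceTensor g K (e.symm x) / m * tensorComp e g x i j := rfl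
    simp only [hT, Matrix.add_apply, Matrix.smul_apply, Matrix.sub_apply, h, hc, smul_eq_mul]
    ring
  have heq : ∀ e ∈ IsManifold.maximalAtlas (𝓡 m) ∞ M, ∀ x ∈ e.target,
      tensorComp e T x = ahlfors (tensorComp e g) (formComp e θ) x := fun e he x hx => by
    rw [hT, hdec.eq_add e he x hx, add_sub_cancel_right]
  have hdiv : IsDivFreeAhlfors g T θ := by
    refine ⟨hg, hdec.smooth, heq, fun e he x hx k => ?_⟩
    have hTs : DiffMat (tensorComp e T) x := fun i j =>
      ((IsMetricAt.smoothMat_ahlfors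
        (by filter_upwards [e.open_target.mem_nhds hx] with y hy using hg.isMetricAt he hy)
        (by filter_upwards [e.open_target.mem_nhds hx] with y hy using
          contDiffAt_formComp hdec.smooth he hy)).diffMat i j).congr_of_eventuallyEq (by
        filter_upwards [e.open_target.mem_nhds hx] with y hy using
          congrFun (congrFun (heq e he y hy) i) j)
    have hφs : DiffMat (tensorComp e φ) x := (smoothMat_tensorComp hdec.isTT.smooth he hx).diffMat
    have h := hvac.momentum e he x hx k
    rw [hK e, divTensor_smul_metric_add (u := fun _ => c / m)
      (A := fun x => tensorComp e T x + tensorComp e φ x) (hg.isMetricAt he hx)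
      (differentiableAt_const _) (fun i j => (hTs i j).fun_add (hφs i j)), divTensor_add hTs hφs,
      hdec.isTT.div_eq_zero e he x hx k, pd_const] at h
    simp only [hc, pd_const] at h
    linarith
  set e := chartAt (EuclideanSpace ℝ (Fin m)) p
  have he : e ∈ IsManifold.maximalAtlas (𝓡 m) ∞ M := IsManifold.chart_mem_maximalAtlas p
  have hp : p ∈ e.source := mem_chart_source _ p
  have h0 := hdiv.tensorComp_eq_zero hm he (e.map_source hp)
  rw [hT, sub_eq_zero] at h0
  have h1 := tensor_ext_of_tensorComp he (e.map_source hp) h0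
  rw [e.left_inv hp] at h1
  rw [← h1, one_div_mul_eq_div]
  ext v w
  exact (add_sub_cancel (traceTensor g K p / m * g p v w) (K p v w)).symm

/-- If `K - (1/m) (trace K) g` is divergence-free, then the momentum constraint reads
`(1/m - 1) d (trace K) = 0`. -/
theorem exists_trace_eq_const [ConnectedSpace M] (hm : 1 < m) (hg : IsRiemannian g)
    (hφ : IsTT g φ) (hvac : VacuumConstraints g K)
    (hH : ∀ e ∈ IsManifold.maximalAtlas (𝓡 m) ∞ M, ∀ x ∈ e.target,
      DifferentiableAt ℝ (fun y => traceTensor g K (e.symm y)) x)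
    (hK : ∀ p, K p = (1 / (m : ℝ) * traceTensor g K p) • g p + φ p) :
    ∃ c : ℝ, ∀ p, traceTensor g K p = c := by
  refine exists_eq_const_of_pd_eq_zero fun e he x hx => ⟨hH e he x hx, fun k => ?_⟩
  have hKe : tensorComp e K = fun x =>
      (1 / (m : ℝ) * traceTensor g K (e.symm x)) • tensorComp e g x + tensorComp e φ x := by
    funext x
    ext i j
    exact congrArg (fun B : TangentSpace (𝓡 m) (e.symm x) →L[ℝ] TangentSpace (𝓡 m) (e.symm x) →L[ℝ]
      ℝ => B (coordVec e x i) (coordVec e x j)) (hK (e.symm x))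
  have h := hvac.momentum e he x hx k
  rw [hKe, divTensor_smul_metric_add (u := fun y => 1 / (m : ℝ) * traceTensor g K (e.symm y))
    (hg.isMetricAt he hx) ((hH e he x hx).const_mul _) (smoothMat_tensorComp hφ.smooth he hx).diffMat,
    hφ.div_eq_zero e he x hx k, pd_mul (differentiableAt_const _) (hH e he x hx), pd_const] at h
  have hm' : (1 / (m : ℝ) - 1) ≠ 0 := by
    have : (1 : ℝ) < m := by exact_mod_cast hm
    exact (sub_neg.2 ((div_lt_one (by linarith)).2 this)).ne
  refine (mul_eq_zero.1 ?_).resolve_left hm'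
  have : pd k ((fun p => traceTensor g K p) ∘ e.symm) x =
    pd k (fun y => traceTensor g K (e.symm y)) x := rfl
  rw [this]
  linarith

end Constraint

end AhlforsVacuum

theorem corollary5 (n : ℕ) (hn : 3 ≤ n)
    {M : Type*} [TopologicalSpace M] [ChartedSpace (EuclideanSpace ℝ (Fin n)) M]
    [IsManifold (𝓡 n) ∞ M] [T2Space M] [CompactSpace M] [ConnectedSpace M]
    {L : Type*} [TopologicalSpace L] [ChartedSpace (EuclideanSpace ℝ (Fin (n + 1))) L]
    [IsManifold (𝓡 (n + 1)) ∞ L]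
    (gL : LorentzianMetric (n + 1) L) (f : M → L)
    (N : ∀ p : M, TangentSpace (𝓡 (n + 1)) (f p))
    (hf : IsSpacelikeHypersurface gL f N)
    (θ : Form n M) (φ : Tensor2 n M)
    (hdec : IsAhlforsDecomposition (inducedMetric gL f)
      (tracelessPart (inducedMetric gL f) (secondFundamentalForm gL f N)) θ φ)
    (hvac : VacuumConstraints (inducedMetric gL f) (secondFundamentalForm gL f N)) :
    (∃ c : ℝ, ∀ p : M, meanCurvature gL f N p = c) ↔
      ∀ p : M, secondFundamentalForm gL f N p =
        (1 / (n : ℝ) * meanCurvature gL f N p) • inducedMetric gL f p + φ p := by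
  have hg := hf.isRiemannian_inducedMetric
  constructor
  · rintro ⟨c, hc⟩
    exact eq_add_of_trace_eq_const (by omega) hg hdec hvac hc
  · exact exists_trace_eq_const (by omega) hg hdec.isTT hvac fun e he x hx =>
      (hf.contDiffAt_meanCurvature hg he hx).differentiableAt (by simp)
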